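/- **Proposition 2 (universality of the discrete qubit–fermion gate set).** Consider systems of $L_{\mathrm q}$ qubits and $L_{\mathrm f}$ fermionic sites, with Hilbert space $\mathcal H_{L_{\mathrm q},L_{\mathrm f}}=(\mathbb C^2)^{\otimes L_{\mathrm q}}\otimes\mathrm{Fock}(L_{\mathrm f})$, fermionic annihilation operators $p_j$ with $\{p_i^\dagger,p_j\}=\delta_{ij}$ and $\{p_i,p_j\}=0$, number operators $n_j=p_j^\dagger p_j$, and $n^{\mathrm q}_i=|1\rangle\langle 1|_i$ on qubit $i$. Consider the gates $$\mathrm{BRAID}_{ij}=e^{i\frac{\pi}{4}(p_i^\dagger-p_i)(p_j^\dagger+p_j)},\qquad \mathrm{CZ}^{\mathrm f}_{ij}=e^{i\pi n_in_j}\quad(i\neq j),\qquad \mathrm{CZ}^{\mathrm{qf}}_{ij}=e^{i\pi n^{\mathrm q}_in_j},\qquad \mathrm T^{\mathrm f}_j=e^{i\frac{\pi}{4}n_j},$$ and the single-qubit gates $\mathrm H=\frac1{\sqrt2}\begin{pmatrix}1&1\\1&-1\end{pmatrix}$, $\mathrm S=\mathrm{diag}(1,i)$, $\mathrm T=\mathrm{diag}(1,e^{i\pi/4})$,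 on arbitrary qubits and sites. Then each of the two gate sets $$\{\mathrm{BRAID},\mathrm{CZ}^{\mathrm f},\mathrm{CZ}^{\mathrm{qf}},\mathrm H,\mathrm S,\mathrm T\}\quad\text{and}\quad\{\mathrm{BRAID},\mathrm{CZ}^{\mathrm f},\mathrm{CZ}^{\mathrm{qf}},\mathrm H,\mathrm S,\mathrm T^{\mathrm f}\}$$ is universal for qubit–fermion quantum computation, in the following sense. For all $L_{\mathrm q},L_{\mathrm f}\ge 0$ there are numbers $a,b\ge 0$ of ancilla qubits and ancilla fermionic sites such that for every unitary $U$ on $\mathcal H_{L_{\mathrm q},L_{\mathrm f}}$ that commutes with the total fermion parity $e^{i\pi\sum_j n_j}$ and every $\varepsilon>0$ there is a finite circuit of gates from the set, acting on $L_{\mathrm q}+a$ qubits and $L_{\mathrm f}+b$ sites and implementing an operator $V$, with $$\big\|V(\psi\otimes|0\rangle_{\mathrm{anc}})-(U\psi)\otimes|0\rangle_{\mathrm{anc}}\big\|\le\varepsilon\|\psi\|\qquad\text{for all }\psi\in\mathcal H_{L_{\mathrm q},L_{\mathrm f}},$$ where $|0\rangle_{\mathrm{anc}}$ is the state in which all ancilla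 qubits are in $|0\rangle$ and all ancilla sites are empty. -/

import Mathlib

open scoped Matrix

noncomputable section

namespace QubitFermion

/-- Classical configurations of `q` qubits and `f` fermionic sites: a bit for each qubit and an
occupation number (0 or 1) for each site.  They label the computational / Fock basis. -/
abbrev Conf (q f : ℕ) : Type := (Fin q → Fin 2) × (Fin f → Fin 2)

/-- The Hilbert space `(ℂ²)^{⊗ q} ⊗ Fock(f)` of `q` qubits and `f` fermionic sites, with
orthonormal basis `|x, s⟩`, where `|s⟩ = (p_f†)^{s_f} ⋯ (p_1†)^{s_1} |vac⟩`. -/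
abbrev States (q f : ℕ) : Type := EuclideanSpace ℂ (Conf q f)

/-- Operators on `States q f`, as matrices in the basis above. -/
abbrev Op (q f : ℕ) : Type := Matrix (Conf q f) (Conf q f) ℂ

variable {q f : ℕ}

/-- The action of an operator on a state. -/
def Op.app (M : Op q f) (ψ : States q f) : States q f :=
  WithLp.toLp 2 (M *ᵥ ψ.ofLp)

/-! ### Elementary operators -/

/-- The single-qubit operator `u` acting on qubit `i` (and as the identity elsewhere). -/
def onQubit (u : Matrix (Fin 2) (Fin 2) ℂ) (i : Fin q) : Op q f :=
  fun c d => if (∀ k, k ≠ i → c.1 k = d.1 k) ∧ c.2 = d.2 then u (c.1 i) (d.1 i) else 0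

/-- The projector `|1⟩⟨1|` on qubit `i`. -/
def qubitNum (i : Fin q) : Op q f := onQubit !![0, 0; 0, 1] i

/-- The fermionic annihilation operator `p_j`.  The sign counts the occupied sites whose creation
operators stand to the left of `p_j†` in the basis vector. -/
def ann (j : Fin f) : Op q f :=
  fun c d =>
    if c.1 = d.1 ∧ d.2 j = 1 ∧ c.2 = Function.update d.2 j 0 then
      (-1 : ℂ) ^ (Finset.univ.filter fun k : Fin f => j < k ∧ d.2 k = 1).card
    else 0

/-- The fermionic creation operator `p_j†`. -/
def cre (j : Fin f) : Op q f := (ann j)ᴴ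

/-- The number operator `n_j = p_j† p_j`. -/
def num (j : Fin f) : Op q f := cre j * ann j

/-- The total fermion parity `exp(i π ∑_j n_j)`. -/
def parity (q f : ℕ) : Op q f :=
  NormedSpace.exp ((Complex.I * (Real.pi : ℂ)) • ∑ j : Fin f, (num j : Op q f))

/-! ### Gates -/

/-- Hadamard gate on qubit `i`. -/
def gateH (i : Fin q) : Op q f :=
  onQubit (((Real.sqrt 2 : ℝ) : ℂ)⁻¹ • !![1, 1; 1, -1]) i

/-- Phase gate on qubit `i`. -/
def gateS (i : Fin q) : Op q f := onQubit !![1, 0; 0, Complex.I] i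

/-- `T` gate on qubit `i`. -/
def gateT (i : Fin q) : Op q f :=
  onQubit !![1, 0; 0, Complex.exp (Complex.I * ((Real.pi : ℂ) / 4))] i

/-- Fermionic `T` gate `exp(i (π/4) n_j)`. -/
def gateTf (j : Fin f) : Op q f :=
  NormedSpace.exp ((Complex.I * ((Real.pi : ℂ) / 4)) • (num j : Op q f))

/-- Fermion-fermion controlled phase gate `exp(i π n_i n_j)`. -/
def gateCZf (i j : Fin f) : Op q f :=
  NormedSpace.exp ((Complex.I * (Real.pi : ℂ)) • ((num i * num j : Op q f)))

/-- Qubit-fermion controlled phase gate `exp(i π n^q_i n_j)`. -/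
def gateCZqf (i : Fin q) (j : Fin f) : Op q f :=
  NormedSpace.exp ((Complex.I * (Real.pi : ℂ)) • ((qubitNum i * num j : Op q f)))

/-- Braiding gate `exp(i (π/4) (p_i† - p_i) (p_j† + p_j))`. -/
def gateBraid (i j : Fin f) : Op q f :=
  NormedSpace.exp ((Complex.I * ((Real.pi : ℂ) / 4)) •
    (((cre i - ann i) * (cre j + ann j) : Op q f)))

/-- The gates `BRAID`, `CZ^f`, `CZ^qf`, `H`, `S`, on all (distinct) sites and all qubits. -/
inductive CliffordGate (q f : ℕ) : Op q f → Prop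
  | braid (i j : Fin f) (hij : i ≠ j) : CliffordGate q f (gateBraid i j)
  | czf (i j : Fin f) (hij : i ≠ j) : CliffordGate q f (gateCZf i j)
  | czqf (i : Fin q) (j : Fin f) : CliffordGate q f (gateCZqf i j)
  | h (i : Fin q) : CliffordGate q f (gateH i)
  | s (i : Fin q) : CliffordGate q f (gateS i)

/-- The gate set `BRAID`, `CZ^f`, `CZ^qf`, `H`, `S`, `T`. -/
def gatesWithT (q f : ℕ) : Set (Op q f) :=
  {M | CliffordGate q f M ∨ ∃ i : Fin q, M = gateT i}

/-- The gate set `BRAID`, `CZ^f`, `CZ^qf`, `H`, `S`, `T^f`. -/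
def gatesWithTf (q f : ℕ) : Set (Op q f) :=
  {M | CliffordGate q f M ∨ ∃ j : Fin f, M = gateTf j}

/-! ### Universality -/

/-- The configuration of `q + a` qubits and `f + b` sites that extends `c` by zeros. -/
def padConf (a b : ℕ) (c : Conf q f) : Conf (q + a) (f + b) :=
  (Fin.append c.1 (fun _ => 0), Fin.append c.2 (fun _ => 0))

/-- The state `ψ ⊗ |0⋯0⟩`: `a` ancilla qubits in `|0⟩` and `b` empty ancilla sites are adjoined,
so that `|x, s⟩` becomes `|x 0⋯0, s 0⋯0⟩`. -/
def attach (a b : ℕ) (ψ : States q f) : States (q + a) (f + b) :=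
  WithLp.toLp 2 fun d => ∑ c : Conf q f, if d = padConf a b c then ψ c else 0

/-- A circuit over a gate set: a product of finitely many gates. -/
def IsCircuit (G : Set (Op q f)) (V : Op q f) : Prop :=
  ∃ L : List (Op q f), (∀ g ∈ L, g ∈ G) ∧ V = L.prod

/-- Physical unitaries of a qubit-fermion system: those that conserve the fermion parity. -/
def IsPhysicalUnitary (U : Op q f) : Prop :=
  U ∈ Matrix.unitaryGroup (Conf q f) ℂ ∧ Commute U (parity q f)

/-- Universality for qubit-fermion quantum computation of a family `G` of gate sets, one for each
number of qubits and sites: with a number of ancillas that depends only on the size of the system,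
every physical unitary is approximated to any accuracy by circuits that return the
ancillas to their initial state. -/
def IsUniversal (G : ∀ q f : ℕ, Set (Op q f)) : Prop :=
  ∀ q f : ℕ, ∃ a b : ℕ, ∀ U : Op q f, IsPhysicalUnitary U → ∀ ε : ℝ, 0 < ε →
    ∃ V : Op (q + a) (f + b), IsCircuit (G (q + a) (f + b)) V ∧
      ∀ ψ : States q f, ‖V.app (attach a b ψ) - attach a b (U.app ψ)‖ ≤ ε * ‖ψ‖

end QubitFermion

end

open scoped Matrix

noncomputable section

set_option linter.unusedSimpArgs false

namespace QubitFermion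

open NormedSpace Filter Topology

/-! ### One-parameter groups inside a closed monoid of a C*-algebra -/

section CStar

variable {A : Type*} [CStarAlgebra A]

/-! Let `C` be the closure of the monoid of circuits on the system with ancillas. By the Lie product
formula (`tendsto_lie_product`), the skew-adjoint `x` with every `exp (t • x)` in `C` form a real
vector space; let `V` be its complex span. The Clifford gates used have finite order, so their
inverses are in `C` and conjugation by them maps `V` to itself. No Lie brackets are taken: `V` is
explored only through such conjugations.

Fix one qubit as control, with Pauli operators `X` and `Z`. An operator `R` on the rest of the
system is a target if `X R` lies in `V`; Hadamard and phase gates allow `X` to be replaced by `Z` or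
`X Z`. The operators `a` on the rest for which `a R` is a target whenever `R` is form an algebra,
the `stabilizer`. Conjugating by a Clifford gate multiplies a target by a Pauli or Majorana
operator, depending on whether the two commute or anticommute. In this way site parities
(`mem_stabilizer_of_controlled`), Majorana pairs (`mem_stabilizer_of_braid`) and the Pauli operators
of the other qubits (`mem_stabilizer_of_qubit`, `mem_stabilizer_of_hadamard`) enter the stabilizer.
Together they generate every parity-conserving operator off the control
(`mem_stabilizer_of_parity`), so all of these are targets as soon as `1` is one.

That `1` is a target is where a non-Clifford gate is needed. Two eighth-turn phase gates about
anticommuting axes compose to a rotation by an angle incommensurable with `π`, whose powers fill a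
one-parameter group densely (`mem_complexGenerators_of_T`). The qubit gate `T` gives `Z` in `V`
directly; the fermionic one gives a site parity, which braiding and a controlled phase carry over to
the control.

Finally, a physical unitary is `U = exp (i K)` with `K` self-adjoint and parity conserving. Then `Z
K` lies in `V`, so `exp (i Z K)` is in `C`. The control ancilla starts in `|0⟩`, where `Z = 1`, so
this operator acts there as `U`. -/

lemma exp_smul_involution {N : A} (hN : N * N = 1) (z : ℂ) :
    exp ((Complex.I * z) • N) = Complex.cos z • (1 : A) + (Complex.I * Complex.sin z) • N := by
  let +nondep : NormedAlgebra ℚ A := .restrictScalars ℚ ℂ A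
  -- The eigenprojections of `N` define a ring homomorphism from `ℂ × ℂ`, where exponentials are
  -- computed coordinatewise.
  let p : A := (2⁻¹ : ℂ) • (1 + N)
  let q : A := (2⁻¹ : ℂ) • (1 - N)
  have hpp : p * p = p := by
    simp only [p, smul_mul_smul_comm, mul_add, add_mul, hN, mul_one, one_mul]; module
  have hqq : q * q = q := by
    simp only [q, smul_mul_smul_comm, mul_sub, sub_mul, hN, mul_one, one_mul]; module
  have hpq : p * q = 0 := by
    simp only [p, q, smul_mul_smul_comm, mul_sub, add_mul, hN, mul_one, one_mul]; module
  have hqp : q * p = 0 := by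
    simp only [p, q, smul_mul_smul_comm, mul_add, sub_mul, hN, mul_one, one_mul]; module
  let F : ℂ × ℂ →+* A :=
    { toFun := fun w => w.1 • p + w.2 • q
      map_one' := by simp only [p, q, Prod.fst_one, Prod.snd_one]; module
      map_zero' := by simp
      map_add' := fun v w => by simp only [Prod.fst_add, Prod.snd_add]; module
      map_mul' := fun v w => by
        simp only [Prod.fst_mul, Prod.snd_mul, mul_add, add_mul, smul_mul_smul_comm, hpp, hqq,
          hpq, hqp]
        module }
  have hF : Continuous F := by
    change Continuous fun w : ℂ × ℂ => w.1 • p + w.2 • q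
    fun_prop
  have h := map_exp F hF (Complex.I * z, -(Complex.I * z))
  have h1 : F (Complex.I * z, -(Complex.I * z)) = (Complex.I * z) • N := by
    change (Complex.I * z) • p + (-(Complex.I * z)) • q = _
    simp only [p, q]; module
  have h2 : F (exp (Complex.I * z, -(Complex.I * z)))
      = Complex.exp (Complex.I * z) • p + Complex.exp (-(Complex.I * z)) • q := by
    change (exp (Complex.I * z, -(Complex.I * z))).1 • p
      + (exp (Complex.I * z, -(Complex.I * z))).2 • q = _
    rw [Prod.fst_exp, Prod.snd_exp, Complex.exp_eq_exp_ℂ]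
  rw [h1, h2] at h
  rw [← h, mul_comm Complex.I z, Complex.exp_mul_I, ← neg_mul, Complex.exp_mul_I,
    Complex.cos_neg, Complex.sin_neg]
  simp only [p, q]
  module

/-- Telescoping: unitary factors preserve the norm, so errors only add up. -/
lemma norm_pow_sub_pow_le_of_unitary {x y : A} (hx : x ∈ unitary A) (hy : y ∈ unitary A) (n : ℕ) :
    ‖x ^ n - y ^ n‖ ≤ n * ‖x - y‖ := by
  induction n with
  | zero => simp
  | succ n ih =>
    have h : x ^ (n + 1) - y ^ (n + 1) = x ^ n * (x - y) + (x ^ n - y ^ n) * y := by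
      rw [pow_succ, pow_succ]; noncomm_ring
    rw [h]
    refine (norm_add_le _ _).trans ?_
    rw [CStarRing.norm_mem_unitary_mul _ (pow_mem hx n), CStarRing.norm_mul_mem_unitary _ hy]
    push_cast
    linarith

lemma exp_real_smul_mem_unitary {x : A} (hx : star x = -x) (t : ℝ) :
    exp (t • x) ∈ unitary A := by
  let +nondep : NormedAlgebra ℚ A := .restrictScalars ℚ ℂ A
  apply exp_mem_unitary_of_mem_skewAdjoint
  rw [skewAdjoint.mem_iff, star_smul, hx]
  simp

/-- The Lie product formula for skew-adjoint elements. -/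
lemma tendsto_lie_product {x y : A} (hx : star x = -x) (hy : star y = -y) :
    Tendsto (fun n : ℕ => (exp ((1 / ((n : ℝ) + 1)) • x) * exp ((1 / ((n : ℝ) + 1)) • y)) ^ (n + 1))
      atTop (𝓝 (exp (x + y))) := by
  let +nondep : NormedAlgebra ℚ A := .restrictScalars ℚ ℂ A
  -- Since `f` vanishes to first order at `0`, `(n + 1) * ‖f (1 / (n + 1))‖` tends to zero; by
  -- telescoping this bounds the error of the `(n + 1)`-st powers.
  let f : ℝ → A := fun h => exp (h • x) * exp (h • y) - exp (h • (x + y))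
  have hf0 : f 0 = 0 := by simp [f]
  have hf : HasDerivAt f 0 0 := by
    have h1 := (hasDerivAt_exp_smul_const (𝕂 := ℝ) x 0)
    have h2 := (hasDerivAt_exp_smul_const (𝕂 := ℝ) y 0)
    have h3 := (hasDerivAt_exp_smul_const (𝕂 := ℝ) (x + y) 0)
    exact (show HasDerivAt f _ 0 from (h1.mul h2).sub h3).congr_deriv (by simp)
  have hs := hasDerivAt_iff_tendsto_slope_zero.1 hf
  have ht : Tendsto (fun n : ℕ => 1 / ((n : ℝ) + 1)) atTop (𝓝[≠] 0) := by
    refine tendsto_nhdsWithin_iff.2 ⟨tendsto_one_div_add_atTop_nhds_zero_nat, ?_⟩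
    exact Eventually.of_forall fun n => by
      have : (0 : ℝ) < 1 / ((n : ℝ) + 1) := by positivity
      exact this.ne'
  have hlim := (hs.comp ht).norm
  rw [norm_zero] at hlim
  rw [tendsto_iff_norm_sub_tendsto_zero]
  refine squeeze_zero (fun _ => norm_nonneg _) (fun n => ?_) hlim
  have hxy : star (x + y) = -(x + y) := by rw [star_add, hx, hy]; abel
  have he : exp (x + y) = exp ((1 / ((n : ℝ) + 1)) • (x + y)) ^ (n + 1) := by
    rw [← exp_nsmul, ← Nat.cast_smul_eq_nsmul ℝ, smul_smul]
    push_cast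
    rw [mul_one_div_cancel (by positivity), one_smul]
  rw [he]
  refine (norm_pow_sub_pow_le_of_unitary
    (mul_mem (exp_real_smul_mem_unitary hx _) (exp_real_smul_mem_unitary hy _))
    (exp_real_smul_mem_unitary hxy _) _).trans ?_
  simp only [Function.comp, zero_add, hf0, sub_zero, norm_smul, f]
  apply le_of_eq
  congr 1
  rw [norm_inv, Real.norm_of_nonneg (by positivity)]
  simp

/-- The infinitesimal generators of the one-parameter groups contained in a closed monoid. -/
def generators (C : Submonoid A) (hC : IsClosed (C : Set A)) : Submodule ℝ A where
  carrier := {x | star x = -x ∧ ∀ t : ℝ, exp (t • x) ∈ C}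
  zero_mem' := by
    refine ⟨by simp, fun t => ?_⟩
    rw [smul_zero, exp_zero]
    exact C.one_mem
  add_mem' := by
    rintro x y ⟨hx, hx'⟩ ⟨hy, hy'⟩
    refine ⟨by rw [star_add, hx, hy]; abel, fun t => ?_⟩
    rw [smul_add]
    refine hC.mem_of_tendsto (tendsto_lie_product (x := t • x) (y := t • y)
      (by simp [hx]) (by simp [hy])) (Eventually.of_forall fun n => ?_)
    refine pow_mem (mul_mem ?_ ?_) _
    · rw [smul_smul]; exact hx' _
    · rw [smul_smul]; exact hy' _
  smul_mem' := by
    rintro r x ⟨hx, hx'⟩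
    exact ⟨by simp [hx], fun t => by rw [smul_smul]; exact hx' _⟩

/-- The complex span of the infinitesimal generators. -/
def complexGenerators (C : Submonoid A) (hC : IsClosed (C : Set A)) : Submodule ℂ A where
  carrier := {x | ∃ a ∈ generators C hC, ∃ b ∈ generators C hC, x = a + Complex.I • b}
  zero_mem' := ⟨0, zero_mem _, 0, zero_mem _, by simp⟩
  add_mem' := by
    rintro _ _ ⟨a, ha, b, hb, rfl⟩ ⟨a', ha', b', hb', rfl⟩
    exact ⟨a + a', add_mem ha ha', b + b', add_mem hb hb', by module⟩
  smul_mem' := by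
    rintro c _ ⟨a, ha, b, hb, rfl⟩
    refine ⟨c.re • a - c.im • b, sub_mem (Submodule.smul_mem _ _ ha) (Submodule.smul_mem _ _ hb),
      c.re • b + c.im • a, add_mem (Submodule.smul_mem _ _ hb) (Submodule.smul_mem _ _ ha), ?_⟩
    have h : c = (c.re : ℂ) + (c.im : ℂ) * Complex.I := (Complex.re_add_im c).symm
    have hr : ∀ (r : ℝ) (x : A), r • x = (r : ℂ) • x := fun r x => (Complex.coe_smul r x).symm
    conv_lhs => rw [h]
    simp only [hr, smul_add, smul_smul, add_smul]
    have hI : (c.im : ℂ) * Complex.I * Complex.I = -(c.im : ℂ) := by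
      rw [mul_assoc, Complex.I_mul_I]; ring
    rw [add_mul, hI]
    module

variable {C : Submonoid A} {hC : IsClosed (C : Set A)}

lemma complexGenerators_of_generators {x : A} (hx : x ∈ generators C hC) :
    x ∈ complexGenerators C hC := ⟨x, hx, 0, zero_mem _, by simp⟩

/-- In `a + i b` with `a`, `b` skew-adjoint, the term `i b` is self-adjoint, so it vanishes when the
sum is skew-adjoint. This is the way back from the complex span to actual one-parameter groups. -/
lemma generators_of_complexGenerators {x : A} (hx : x ∈ complexGenerators C hC)
    (hs : star x = -x) : x ∈ generators C hC := by
  obtain ⟨a, ha, b, hb, rfl⟩ := hx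
  have h : Complex.I • b = 0 := by
    rw [star_add, star_smul, ha.1, hb.1] at hs
    simp only [Complex.star_def, Complex.conj_I, neg_smul, smul_neg, neg_neg, neg_add] at hs
    have : Complex.I • b = -(Complex.I • b) := add_left_cancel hs
    have h2 : (2 : ℂ) • (Complex.I • b) = 0 := by
      rw [two_smul]; nth_rewrite 2 [this]; exact add_neg_cancel _
    exact (smul_eq_zero.1 h2).resolve_left two_ne_zero
  rw [h, add_zero]
  exact ha

/-- The unitaries that normalize the complexified Lie algebra. -/
def normalizer (V : Submodule ℂ A) : Submonoid A where
  carrier := {g | g ∈ unitary A ∧ ∀ x ∈ V, g * x * star g ∈ V}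
  one_mem' := ⟨one_mem _, fun x hx => by simpa using hx⟩
  mul_mem' := by
    rintro g h ⟨hg, hg'⟩ ⟨hh, hh'⟩
    refine ⟨mul_mem hg hh, fun x hx => ?_⟩
    have := hg' _ (hh' x hx)
    rwa [star_mul, show g * h * x * (star h * star g) = g * (h * x * star h) * star g by
      simp only [mul_assoc]]

/-- Conjugation commutes with `exp`. As `C` is only a monoid, the inverse `star g` has to be assumed
in `C` as well. -/
lemma mem_normalizer_of_mem {g : A} (hu : g ∈ unitary A) (h1 : g ∈ C) (h2 : star g ∈ C) :
    g ∈ normalizer (complexGenerators C hC) := by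
  let +nondep : NormedAlgebra ℚ A := .restrictScalars ℚ ℂ A
  have key : ∀ x ∈ generators C hC, g * x * star g ∈ generators C hC := by
    rintro x ⟨hx, hx'⟩
    refine ⟨by simp [hx, mul_assoc], fun t => ?_⟩
    let u : Aˣ := ⟨g, star g, (Unitary.mem_iff.1 hu).2, (Unitary.mem_iff.1 hu).1⟩
    have := exp_units_conj u (t • x)
    have e : t • (g * x * star g) = u * (t • x) * ↑u⁻¹ := by
      change _ = g * (t • x) * star g
      simp
    rw [e, this]
    exact mul_mem (mul_mem h1 (hx' t)) h2
  refine ⟨hu, ?_⟩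
  rintro _ ⟨a, ha, b, hb, rfl⟩
  exact ⟨_, key a ha, _, key b hb, by simp [mul_add, add_mul]⟩

/-- The inverse of an element of finite order is one of its powers; this is how circuits without
inverse gates obtain inverses. -/
lemma star_mem_of_pow_eq_one {g : A} (hu : g ∈ unitary A) (h1 : g ∈ C) {n : ℕ}
    (hn : g ^ (n + 1) = 1) : star g ∈ C := by
  have : star g = g ^ n := by
    calc star g = star g * g ^ (n + 1) := by rw [hn, mul_one]
      _ = (star g * g) * g ^ n := by rw [pow_succ', mul_assoc]
      _ = g ^ n := by rw [(Unitary.mem_iff.1 hu).1, one_mul]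
  rw [this]
  exact pow_mem h1 n

/-! ### Irrational rotations from `T` gates -/

/-- Otherwise `exp (i θ)` is a root of unity and `x = 2 cos θ = 1 + √2 / 2` is an algebraic integer.
But `x² - 2x = -1/2` is not one. -/
lemma irrational_arccos_div_two_pi :
    Irrational (8 * Real.arccos ((2 + √2) / 4) / (2 * Real.pi)) := by
  rintro ⟨r, hr⟩
  set θ := Real.arccos ((2 + √2) / 4) with hθ
  have h2 : √2 ≤ 2 := by
    rw [Real.sqrt_le_left (by norm_num)]; norm_num
  have hcos : Real.cos θ = (2 + √2) / 4 :=
    Real.cos_arccos (by linarith [Real.sqrt_nonneg 2]) (by linarith)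
  have hpi := Real.pi_pos
  have hpow : Complex.exp (θ * Complex.I) ^ (8 * r.den) = 1 := by
    rw [← Complex.exp_nat_mul, Complex.exp_eq_one_iff]
    refine ⟨r.num, ?_⟩
    have h1 : (r.den : ℝ) * (8 * θ) = r.num * (2 * Real.pi) := by
      have : (8 * θ) = r * (2 * Real.pi) := by rw [hr]; field_simp
      rw [this, Rat.cast_def]
      have : (r.den : ℝ) ≠ 0 := by exact_mod_cast r.den_ne_zero
      field_simp
    have h1' : (r.den : ℂ) * (8 * θ) = r.num * (2 * Real.pi) := by exact_mod_cast h1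
    push_cast
    linear_combination Complex.I * h1'
  have hint : ∀ z : ℂ, z ^ (8 * r.den) = 1 → IsIntegral ℤ z := fun z hz =>
    IsIntegral.of_pow (n := 8 * r.den) (Nat.mul_pos (by norm_num) r.den_pos) (by rw [hz]; exact isIntegral_one)
  have hpow' : Complex.exp (-θ * Complex.I) ^ (8 * r.den) = 1 := by
    rw [neg_mul, Complex.exp_neg, inv_pow, hpow, inv_one]
  have hx : IsIntegral ℤ (2 * Complex.cos θ) := by
    rw [Complex.two_cos]
    exact (hint _ hpow).add (hint _ hpow')
  have hval : (2 * Complex.cos θ) = 1 + ((√2 : ℝ) : ℂ) / 2 := by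
    rw [← Complex.ofReal_cos, hcos]; push_cast; ring
  have hsq : ((√2 : ℝ) : ℂ) ^ 2 = 2 := by
    rw [← Complex.ofReal_pow, Real.sq_sqrt (by norm_num)]; norm_num
  have hhalf : IsIntegral ℤ (-(1 / 2) : ℂ) := by
    have : (-(1 / 2) : ℂ) = (2 * Complex.cos θ) * (2 * Complex.cos θ)
        - ((2 * Complex.cos θ) + (2 * Complex.cos θ)) := by
      rw [hval]; linear_combination (-1 / 4) * hsq
    rw [this]
    exact (hx.mul hx).sub (hx.add hx)
  have hq : IsIntegral ℤ (-(1 / 2) : ℚ) := by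
    rw [← isIntegral_algebraMap_iff (algebraMap ℚ ℂ).injective]
    simpa using hhalf
  obtain ⟨m, hm⟩ := IsIntegrallyClosed.isIntegral_iff.1 hq
  have : (2 : ℚ) * m = -1 := by
    simp only [eq_intCast] at hm
    rw [hm]; norm_num
  have : (2 : ℤ) * m = -1 := by exact_mod_cast this
  omega

/-- The combination with parameter `a` has eigenvalue `1` where `P = 1` and `a` where `P = -1`, so
parameters multiply. The phase gates are the cases `a = i` and `a = exp (i π / 4)`. -/
lemma involution_combination_mul {P : A} (hP : P * P = 1) (a b : ℂ) :
    (((1 + a) / 2) • (1 : A) + ((1 - a) / 2) • P) * (((1 + b) / 2) • (1 : A) + ((1 - b) / 2) • P)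
      = ((1 + a * b) / 2) • (1 : A) + ((1 - a * b) / 2) • P := by
  simp only [mul_add, add_mul, smul_mul_smul_comm, mul_one, one_mul, hP]
  module

lemma involution_combination_pow {P : A} (hP : P * P = 1) (a : ℂ) (n : ℕ) :
    (((1 + a) / 2) • (1 : A) + ((1 - a) / 2) • P) ^ n
      = ((1 + a ^ n) / 2) • (1 : A) + ((1 - a ^ n) / 2) • P := by
  induction n with
  | zero => simp
  | succ n ih => rw [pow_succ, ih, involution_combination_mul hP, pow_succ]

lemma star_involution_combination {P : A} (hP : star P = P) (a : ℂ) :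
    star (((1 + a) / 2) • (1 : A) + ((1 - a) / 2) • P)
      = ((1 + star a) / 2) • (1 : A) + ((1 - star a) / 2) • P := by
  simp [star_add, star_smul, hP]

lemma involution_combination_mem_unitary {P : A} (hP : P * P = 1) (hPs : star P = P) {a : ℂ}
    (ha : star a * a = 1) :
    ((1 + a) / 2) • (1 : A) + ((1 - a) / 2) • P ∈ unitary A := by
  rw [Unitary.mem_iff, star_involution_combination hPs, involution_combination_mul hP,
    involution_combination_mul hP, mul_comm a, ha]
  simp

/-- The one-parameter group generated by a self-adjoint involution lies in a closed monoid as
soon as it contains a rotation by an irrational angle and its inverse. -/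
lemma mem_complexGenerators_of_irrational {N : A} (hN : N * N = 1) (hNs : star N = N) {α : ℝ}
    (hα : Irrational (α / (2 * Real.pi))) (h1 : exp ((Complex.I * α) • N) ∈ C)
    (h2 : star (exp ((Complex.I * α) • N)) ∈ C) : N ∈ complexGenerators C hC := by
  let +nondep : NormedAlgebra ℚ A := .restrictScalars ℚ ℂ A
  let S : AddSubgroup ℝ :=
    { carrier := {t | exp ((Complex.I * t) • N) ∈ C ∧ star (exp ((Complex.I * t) • N)) ∈ C}
      zero_mem' := by simp [C.one_mem]
      add_mem' := by
        rintro s t ⟨hs, hs'⟩ ⟨ht, ht'⟩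
        have : exp ((Complex.I * ((s + t : ℝ) : ℂ)) • N)
            = exp ((Complex.I * s) • N) * exp ((Complex.I * t) • N) := by
          rw [← exp_add_of_commute]
          · congr 1; push_cast; module
          · exact ((Commute.refl N).smul_left _).smul_right _
        refine ⟨?_, ?_⟩
        · rw [this]; exact mul_mem hs ht
        · rw [this, star_mul]; exact mul_mem ht' hs'
      neg_mem' := by
        rintro t ⟨ht, ht'⟩
        have : exp ((Complex.I * ((-t : ℝ) : ℂ)) • N) = star (exp ((Complex.I * t) • N)) := by
          rw [star_exp, star_smul, hNs]
          simp
        refine ⟨?_, ?_⟩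
        · rw [this]; exact ht'
        · rw [this, star_star]; exact ht }
  have hmem : α ∈ S := ⟨h1, h2⟩
  -- The period is added because `α` and `2π` together, being incommensurable, generate a dense
  -- subgroup of `ℝ`.
  have hpi : 2 * Real.pi ∈ S := by
    have : exp ((Complex.I * ((2 * Real.pi : ℝ) : ℂ)) • N) = 1 := by
      rw [exp_smul_involution hN]; push_cast; simp
    refine ⟨?_, ?_⟩
    · rw [this]; exact C.one_mem
    · rw [this, star_one]; exact C.one_mem
  have hcont : Continuous fun t : ℝ => exp ((Complex.I * t) • N) := by
    simp_rw [exp_smul_involution hN]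
    fun_prop
  have hclosed : IsClosed ((fun t : ℝ => exp ((Complex.I * t) • N)) ⁻¹' (C : Set A)) :=
    hC.preimage hcont
  have hdense : Dense (AddSubgroup.closure {α, 2 * Real.pi} : Set ℝ) :=
    dense_addSubgroupClosure_pair_iff.2 hα
  have hsub : (AddSubgroup.closure {α, 2 * Real.pi} : Set ℝ)
      ⊆ (fun t : ℝ => exp ((Complex.I * t) • N)) ⁻¹' (C : Set A) := by
    intro t ht
    have : AddSubgroup.closure {α, 2 * Real.pi} ≤ S := by
      rw [AddSubgroup.closure_le]
      rintro x (rfl | rfl)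
      · exact hmem
      · exact hpi
    exact (this ht).1
  have hall : ∀ t : ℝ, exp ((Complex.I * t) • N) ∈ C := fun t => by
    have := hclosed.closure_subset_iff.2 hsub (hdense t)
    exact this
  have hgen : Complex.I • N ∈ generators C hC := by
    refine ⟨by simp [star_smul, hNs], fun t => ?_⟩
    have : t • Complex.I • N = (Complex.I * t) • N := by
      rw [← Complex.coe_smul t, smul_smul, mul_comm]
    rw [this]
    exact hall t
  have := (complexGenerators C hC).smul_mem (-Complex.I) (complexGenerators_of_generators hgen)
  simpa [smul_smul] using this

/-- Two `T` gates about anticommuting axes generate the one-parameter group about the first. -/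
lemma mem_complexGenerators_of_T {P Q : A} (hP : P * P = 1) (hQ : Q * Q = 1)
    (hPs : star P = P) (hQs : star Q = Q) (hPQ : Q * P = -(P * Q)) {ω : ℂ}
    (hω : ω = Complex.exp (Complex.I * (Real.pi / 4)))
    (hTP : ((1 + ω) / 2) • (1 : A) + ((1 - ω) / 2) • P ∈ C)
    (hTQ : ((1 + ω) / 2) • (1 : A) + ((1 - ω) / 2) • Q ∈ C) :
    P ∈ complexGenerators C hC := by
  let +nondep : NormedAlgebra ℚ A := .restrictScalars ℚ ℂ A
  have hω4 : ω ^ 4 = -1 := by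
    rw [hω, ← Complex.exp_nat_mul, ← Complex.exp_pi_mul_I]; congr 1; push_cast; ring
  have hω8 : ω ^ 8 = 1 := by
    rw [show ω ^ 8 = (ω ^ 4) ^ 2 by ring, hω4]; norm_num
  have hωs : star ω = ω ^ 7 := by
    have hn : star ω * ω = 1 := by
      rw [hω, Complex.star_def, ← Complex.exp_conj, ← Complex.exp_add, Complex.exp_eq_one_iff]
      refine ⟨0, ?_⟩
      simp [Complex.conj_ofNat]
    calc star ω = star ω * ω ^ 8 := by rw [hω8, mul_one]
      _ = (star ω * ω) * ω ^ 7 := by ring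
      _ = ω ^ 7 := by rw [hn, one_mul]
  -- The fourth power of the gate has parameter `ω ^ 4 = -1`, which is `P` itself.
  have hPC : P ∈ C := by
    have := pow_mem hTP 4
    rw [involution_combination_pow hP, hω4] at this
    norm_num at this
    exact this
  have hTP' : star (((1 + ω) / 2) • (1 : A) + ((1 - ω) / 2) • P) ∈ C := by
    rw [star_involution_combination hPs, hωs, ← involution_combination_pow hP]
    exact pow_mem hTP 7
  have hTQ' : star (((1 + ω) / 2) • (1 : A) + ((1 - ω) / 2) • Q) ∈ C := by
    rw [star_involution_combination hQs, hωs, ← involution_combination_pow hQ]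
    exact pow_mem hTQ 7
  set c := Real.cos (Real.pi / 8) with hc
  set s := Real.sin (Real.pi / 8) with hs
  have hcs1 : s ^ 2 + c ^ 2 = 1 := Real.sin_sq_add_cos_sq _
  have hcos : c ^ 2 = (2 + √2) / 4 := by
    rw [hc, Real.cos_sq, show 2 * (Real.pi / 8) = Real.pi / 4 by ring, Real.cos_pi_div_four]
    ring
  have hsin : 0 < s := Real.sin_pos_of_pos_of_lt_pi (by positivity) (by linarith [Real.pi_pos])
  have hcpos : 0 < c := Real.cos_pos_of_mem_Ioo ⟨by linarith [Real.pi_pos], by linarith [Real.pi_pos]⟩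
  set θ := Real.arccos ((2 + √2) / 4) with hθ
  have hcθ : Real.cos θ = c ^ 2 := by
    rw [hcos]
    exact Real.cos_arccos (by linarith [Real.sqrt_nonneg 2]) (by nlinarith)
  have hsθ2 : Real.sin θ ^ 2 = 2 * c ^ 2 * s ^ 2 + s ^ 4 := by
    rw [Real.sin_sq, hcθ, show c ^ 2 = 1 - s ^ 2 by linarith]; ring
  have hsθ : Real.sin θ ≠ 0 := by
    intro h
    rw [h] at hsθ2
    have : 0 < 2 * c ^ 2 * s ^ 2 + s ^ 4 := by positivity
    linarith
  set σ := Real.sin θ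
  have hσ2 : ((σ : ℂ)) ^ 2 = 2 * c ^ 2 * s ^ 2 + s ^ 4 := by exact_mod_cast hsθ2
  have hσ0 : (σ : ℂ) ≠ 0 := by exact_mod_cast hsθ
  have hcsC : (s : ℂ) ^ 2 + c ^ 2 = 1 := by exact_mod_cast hcs1
  -- Up to the phase `exp (i π / 8)` the two gates are `c - i s P` and `c - i s Q`. Their product is
  -- `c² + i N₀`, so `N₀` is the unnormalized rotation axis and `c² = cos θ`.
  let N₀ : A := (-(c * s : ℂ)) • (P + Q) + (Complex.I * s ^ 2) • (P * Q)
  have e1 : P * (P * Q) = Q := by rw [← mul_assoc, hP, one_mul]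
  have e2 : Q * (P * Q) = -P := by rw [← mul_assoc, hPQ, neg_mul, mul_assoc, hQ, mul_one]
  have e3 : P * Q * P = -Q := by rw [mul_assoc, hPQ, mul_neg, e1]
  have e4 : P * Q * Q = P := by rw [mul_assoc, hQ, mul_one]
  have e5 : P * Q * (P * Q) = -1 := by rw [mul_assoc, e2, mul_neg, hP]
  have hN₀ : N₀ * N₀ = ((σ : ℂ) ^ 2) • (1 : A) := by
    simp only [N₀, mul_add, add_mul, smul_mul_smul_comm, smul_add, hP, hQ, hPQ, e1, e2, e3, e4, e5]
    rw [hσ2]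
    have hI : Complex.I * (s : ℂ) ^ 2 * (Complex.I * (s : ℂ) ^ 2) = -(s : ℂ) ^ 4 := by
      linear_combination (s : ℂ) ^ 4 * Complex.I_mul_I
    rw [hI]
    module
  let N : A := (σ : ℂ)⁻¹ • N₀
  have hN : N * N = 1 := by
    simp only [N, smul_mul_smul_comm, hN₀, smul_smul]
    rw [show (σ : ℂ)⁻¹ * (σ : ℂ)⁻¹ * (σ : ℂ) ^ 2 = 1 by field_simp, one_smul]
  have hNs : star N = N := by
    simp only [N, N₀, star_add, star_smul, star_mul, hPs, hQs, hPQ]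
    simp [-Complex.coe_smul, mul_comm ((s : ℂ) ^ 2)]
  have hη : Complex.exp (Complex.I * (Real.pi / 8)) = c + Complex.I * s := by
    rw [mul_comm, Complex.exp_mul_I, hc, hs]; push_cast; ring
  have hω2 : ω = (c + Complex.I * s) ^ 2 := by
    rw [← hη, ← Complex.exp_nat_mul, hω]; congr 1; push_cast; ring
  have hRot : (((1 + ω) / 2) • (1 : A) + ((1 - ω) / 2) • P)
      * (((1 + ω) / 2) • (1 : A) + ((1 - ω) / 2) • Q) = ω • exp ((Complex.I * θ) • N) := by
    rw [exp_smul_involution hN, ← Complex.ofReal_cos, ← Complex.ofReal_sin, hcθ]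
    have h1 : (1 + ω) / 2 = (c + Complex.I * s) * c := by
      rw [hω2]; linear_combination (-1/2) * hcsC + (s : ℂ) ^ 2 / 2 * Complex.I_mul_I
    have h2 : (1 - ω) / 2 = (c + Complex.I * s) * (-Complex.I * s) := by
      rw [hω2]; linear_combination (-1/2) * hcsC + (s : ℂ) ^ 2 / 2 * Complex.I_mul_I
    have h3 : (Complex.I * ((Real.sin θ : ℝ) : ℂ)) • N = Complex.I • N₀ := by
      change (Complex.I * (σ : ℂ)) • ((σ : ℂ)⁻¹ • N₀) = Complex.I • N₀
      rw [smul_smul, mul_assoc, mul_inv_cancel₀ hσ0, mul_one]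
    rw [h3, h1, h2, hω2]
    simp only [N₀, smul_smul, mul_add, add_mul, smul_mul_smul_comm, smul_add, mul_one,
      one_mul]
    have h6 : (((c ^ 2 : ℝ)) : ℂ) = (c : ℂ) ^ 2 := by push_cast; ring
    rw [h6]
    match_scalars <;> (try simp only [mul_one]) <;> ring_nf
  -- The eighth power removes the scalar `ω`, which is why the angle is `8 θ`.
  have hpow : exp ((Complex.I * ((8 * θ : ℝ) : ℂ)) • N)
      = ((((1 + ω) / 2) • (1 : A) + ((1 - ω) / 2) • P)
        * (((1 + ω) / 2) • (1 : A) + ((1 - ω) / 2) • Q)) ^ 8 := by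
    rw [hRot, smul_pow, hω8, one_smul, ← exp_nsmul, ← Nat.cast_smul_eq_nsmul ℂ,
      show Complex.I * ((8 * θ : ℝ) : ℂ) = ((8 : ℕ) : ℂ) * (Complex.I * θ) by push_cast; ring,
      mul_smul ((8 : ℕ) : ℂ)]
  have hNmem : N ∈ complexGenerators C hC := by
    refine mem_complexGenerators_of_irrational hN hNs irrational_arccos_div_two_pi ?_ ?_
    · rw [hpow]; exact pow_mem (mul_mem hTP hTQ) 8
    · rw [hpow, star_pow, star_mul]; exact pow_mem (mul_mem hTQ' hTP') 8
  -- Conjugation by `P` fixes `P` and changes the sign of `Q` and `P Q`; averaging `N` over it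
  -- leaves a nonzero multiple of `P`.
  have hPn : P ∈ normalizer (complexGenerators C hC) :=
    mem_normalizer_of_mem (Unitary.mem_iff.2 ⟨by rw [hPs, hP], by rw [hPs, hP]⟩) hPC
      (by rwa [hPs])
  have hsum := add_mem hNmem (hPn.2 N hNmem)
  have : N + P * N * star P = (-(2 * c * s) / σ : ℂ) • P := by
    rw [hPs]
    have e6 : P * Q * P = -Q := e3
    have e7 : P * (P * Q) * P = -(P * Q) := by rw [e1, hPQ]
    simp only [N, N₀, mul_add, add_mul, mul_smul_comm, smul_mul_assoc, smul_add, hP, e6, e7,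
      one_mul]
    module
  rw [this] at hsum
  have hne : (-(2 * c * s) / σ : ℂ) ≠ 0 := by
    have h1 : (c : ℂ) ≠ 0 := by exact_mod_cast hcpos.ne'
    have h2 : (s : ℂ) ≠ 0 := by exact_mod_cast hsin.ne'
    exact div_ne_zero (neg_ne_zero.2 (mul_ne_zero (mul_ne_zero two_ne_zero h1) h2)) hσ0
  exact ((complexGenerators C hC).smul_mem_iff hne).1 hsum

end CStar

/-- This and the next two give commutation relations in a form that `simp` can apply inside
right-associated words. -/
lemma mul_assoc_of_eq {A : Type*} [Ring A] {a b c d : A} (h : a * b = c * d) (y : A) :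
    a * (b * y) = c * (d * y) := by
  rw [← mul_assoc, h, mul_assoc]

lemma mul_assoc_of_eq_neg {A : Type*} [Ring A] {a b c d : A} (h : a * b = -(c * d)) (y : A) :
    a * (b * y) = -(c * (d * y)) := by
  rw [← mul_assoc, h, neg_mul, mul_assoc]

lemma mul_assoc_of_eq_one {A : Type*} [Ring A] {a b : A} (h : a * b = 1) (y : A) :
    a * (b * y) = y := by
  rw [← mul_assoc, h, one_mul]

/-! ### Targets of a control qubit and their stabilizer -/

section Control

variable {A : Type*} [Ring A] [Algebra ℂ A]

/-- The two-sided multiplication by `g` and `g'` preserves the subspace `V`. -/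
def Preserves (V : Submodule ℂ A) (g g' : A) : Prop := ∀ y ∈ V, g * y * g' ∈ V

variable {V : Submodule ℂ A}

lemma Preserves.mul {g g' h h' : A} (hg : Preserves V g g') (hh : Preserves V h h') :
    Preserves V (g * h) (h' * g') := fun y hy => by
  have := hg _ (hh y hy)
  simpa only [mul_assoc] using this

/-- Normalizing scalars do not matter, so gates can be replaced by multiples such as `X + Z` or `1 +
i M`. -/
lemma Preserves.of_smul {g g' : A} {a b : ℂ} (ha : a ≠ 0) (hb : b ≠ 0)
    (h : Preserves V (a • g) (b • g')) : Preserves V g g' := fun y hy => by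
  have := h y hy
  rw [smul_mul_assoc, smul_mul_smul_comm] at this
  exact (V.smul_mem_iff (mul_ne_zero ha hb)).1 this

/-- Two anticommuting involutions, the Pauli operators `X` and `Z` of a control qubit, such that
conjugation by the Hadamard and the phase gate of this qubit preserves the subspace `V`. -/
structure ControlQubit (V : Submodule ℂ A) where
  x : A
  z : A
  xx : x * x = 1
  zz : z * z = 1
  zx : z * x = -(x * z)
  hadamard : Preserves V (x + z) (x + z)
  phase : Preserves V (1 - Complex.I • z) (1 + Complex.I • z)

namespace ControlQubit

variable (Q : ControlQubit V)

/-- The operators `R` on the complement of the control qubit for which `X ⊗ R` lies in `V`. -/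
def targets : Submodule ℂ A where
  carrier := {R | R * Q.x = Q.x * R ∧ R * Q.z = Q.z * R ∧ Q.x * R ∈ V}
  zero_mem' := by simp
  add_mem' := by
    rintro a b ⟨h1, h2, h3⟩ ⟨h1', h2', h3'⟩
    refine ⟨by rw [add_mul, mul_add, h1, h1'], by rw [add_mul, mul_add, h2, h2'], ?_⟩
    rw [mul_add]; exact add_mem h3 h3'
  smul_mem' := by
    rintro c a ⟨h1, h2, h3⟩
    refine ⟨by rw [smul_mul_assoc, mul_smul_comm, h1], by rw [smul_mul_assoc, mul_smul_comm, h2], ?_⟩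
    rw [mul_smul_comm]; exact V.smul_mem _ h3

variable {Q} {R : A}

lemma z_mul_mem_of_targets (hR : R ∈ Q.targets) : Q.z * R ∈ V := by
  obtain ⟨h1, h2, h3⟩ := hR
  have := Q.hadamard _ h3
  refine (V.smul_mem_iff (two_ne_zero (α := ℂ))).1 ?_
  convert this using 1
  simp only [mul_add, add_mul, mul_assoc, h1, h2, Q.xx, Q.zz, Q.zx, mul_assoc_of_eq h1,
    mul_assoc_of_eq h2, mul_assoc_of_eq_one Q.xx, mul_assoc_of_eq_one Q.zz,
    mul_assoc_of_eq_neg Q.zx, mul_neg, neg_mul, neg_neg]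
  module

lemma targets_of_z_mul_mem (h1 : R * Q.x = Q.x * R) (h2 : R * Q.z = Q.z * R)
    (h : Q.z * R ∈ V) : R ∈ Q.targets := by
  have := Q.hadamard _ h
  refine ⟨h1, h2, (V.smul_mem_iff (two_ne_zero (α := ℂ))).1 ?_⟩
  convert this using 1
  simp only [mul_add, add_mul, mul_assoc, h1, h2, Q.xx, Q.zz, Q.zx, mul_assoc_of_eq h1,
    mul_assoc_of_eq h2, mul_assoc_of_eq_one Q.xx, mul_assoc_of_eq_one Q.zz,
    mul_assoc_of_eq_neg Q.zx, mul_neg, neg_mul, neg_neg]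
  module

/-- The phase gate turns `X Z` into a multiple of `X`; the factor `2 i` comes from the missing
normalization. -/
lemma targets_of_x_mul_z_mul_mem (h1 : R * Q.x = Q.x * R) (h2 : R * Q.z = Q.z * R)
    (h : Q.x * (Q.z * R) ∈ V) : R ∈ Q.targets := by
  have := Q.phase _ h
  have h2I : (2 * Complex.I : ℂ) ≠ 0 := mul_ne_zero two_ne_zero Complex.I_ne_zero
  refine ⟨h1, h2, (V.smul_mem_iff h2I).1 ?_⟩
  convert this using 1
  simp only [mul_add, add_mul, sub_mul, mul_assoc, h1, h2, mul_assoc_of_eq h1,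
    mul_assoc_of_eq h2, mul_assoc_of_eq_one Q.xx, mul_assoc_of_eq_one Q.zz, smul_mul_assoc,
    mul_smul_comm, smul_smul, mul_one, one_mul,
    mul_assoc_of_eq_neg Q.zx, mul_neg, neg_mul, neg_neg, Complex.I_mul_I,
    smul_add, smul_neg, smul_sub]
  module

lemma preserves_z : Preserves V Q.z Q.z := by
  have h := Q.phase.mul Q.phase
  have e1 : (1 - Complex.I • Q.z) * (1 - Complex.I • Q.z) = (-2 * Complex.I) • Q.z := by
    simp only [mul_sub, sub_mul, mul_one, one_mul, smul_mul_smul_comm, Q.zz, Complex.I_mul_I]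
    module
  have e2 : (1 + Complex.I • Q.z) * (1 + Complex.I • Q.z) = (2 * Complex.I) • Q.z := by
    simp only [mul_add, add_mul, mul_one, one_mul, smul_mul_smul_comm, Q.zz, Complex.I_mul_I]
    module
  rw [e1, e2] at h
  exact h.of_smul (by simp) (by simp)

/-- `Z` is the square of the phase gate up to a scalar, and `X = H Z H`. -/
lemma preserves_x : Preserves V Q.x Q.x := by
  have h := (Q.hadamard.mul Q.preserves_z).mul Q.hadamard
  have e1 : (Q.x + Q.z) * Q.z * (Q.x + Q.z) = (2 : ℂ) • Q.x := by
    simp only [mul_add, add_mul, mul_assoc, Q.xx, Q.zz, Q.zx, mul_assoc_of_eq_one Q.xx,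
      mul_assoc_of_eq_one Q.zz, mul_neg, neg_mul, neg_neg, mul_one, one_mul]
    module
  rw [← mul_assoc, e1] at h
  exact h.of_smul (by simp) (by simp)

/-- Conjugation by an operator on the complement of the control qubit. -/
lemma targets_conj {g g' : A} (hg : Preserves V g g') (hx : g * Q.x = Q.x * g)
    (hz : g * Q.z = Q.z * g) (hx' : g' * Q.x = Q.x * g') (hz' : g' * Q.z = Q.z * g')
    (hR : R ∈ Q.targets) : g * R * g' ∈ Q.targets := by
  obtain ⟨h1, h2, h3⟩ := hR
  refine ⟨?_, ?_, ?_⟩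
  · simp only [mul_assoc, hx', mul_assoc_of_eq h1, mul_assoc_of_eq hx]
  · simp only [mul_assoc, hz', mul_assoc_of_eq h2, mul_assoc_of_eq hz]
  · have := hg _ h3
    rwa [show g * (Q.x * R) * g' = Q.x * (g * R * g') by
      simp only [mul_assoc, mul_assoc_of_eq hx]] at this

variable (Q) in
/-- The operators on the complement of the control qubit that stabilize the target space. -/
def stabilizer : Subalgebra ℂ A where
  carrier := {a | a * Q.x = Q.x * a ∧ a * Q.z = Q.z * a ∧ ∀ R ∈ Q.targets, a * R ∈ Q.targets}
  mul_mem' := by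
    rintro a b ⟨h1, h2, h3⟩ ⟨h1', h2', h3'⟩
    refine ⟨?_, ?_, fun R hR => ?_⟩
    · simp only [mul_assoc, h1', mul_assoc_of_eq h1]
    · simp only [mul_assoc, h2', mul_assoc_of_eq h2]
    · rw [mul_assoc]; exact h3 _ (h3' _ hR)
  add_mem' := by
    rintro a b ⟨h1, h2, h3⟩ ⟨h1', h2', h3'⟩
    refine ⟨by rw [add_mul, mul_add, h1, h1'], by rw [add_mul, mul_add, h2, h2'], fun R hR => ?_⟩
    rw [add_mul]; exact add_mem (h3 _ hR) (h3' _ hR)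
  algebraMap_mem' := fun r => by
    refine ⟨Algebra.commutes _ _, Algebra.commutes _ _, fun R hR => ?_⟩
    rw [← Algebra.smul_def]; exact Q.targets.smul_mem _ hR

/-- To stabilize the targets it is enough to do so on those that commute or anticommute with a
given involution. -/
lemma mul_mem_targets_of_split {u a : A} (huu : u * u = 1) (hu : Preserves V u u)
    (hx : u * Q.x = Q.x * u) (hz : u * Q.z = Q.z * u)
    (p : A → Prop) (hp : ∀ R, p R → p (R + u * R * u) ∧ p (R - u * R * u))
    (h1 : ∀ R ∈ Q.targets, p R → u * R = R * u → a * R ∈ Q.targets)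
    (h2 : ∀ R ∈ Q.targets, p R → u * R = -(R * u) → a * R ∈ Q.targets)
    (hR : R ∈ Q.targets) (hpR : p R) : a * R ∈ Q.targets := by
  have hc := targets_conj hu hx hz hx hz hR
  have k1 := h1 _ (add_mem hR hc) (hp R hpR).1 (by
    simp only [mul_add, add_mul, mul_assoc, huu, mul_assoc_of_eq_one huu, mul_one]; abel)
  have k2 := h2 _ (sub_mem hR hc) (hp R hpR).2 (by
    simp only [mul_sub, sub_mul, mul_assoc, huu, mul_assoc_of_eq_one huu, mul_one]; abel)
  refine (Q.targets.smul_mem_iff (two_ne_zero (α := ℂ))).1 ?_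
  convert add_mem k1 k2 using 1
  rw [mul_add, mul_sub]
  module

/-- The involution `u` and the controlled-`u` gate. -/
lemma preserves_of_controlled {u : A} (huu : u * u = 1)
    (hx : u * Q.x = Q.x * u) (hz : u * Q.z = Q.z * u)
    (hc : Preserves V (1 + Q.z + u - Q.z * u) (1 + Q.z + u - Q.z * u)) : Preserves V u u := by
  -- Half of `1 + Z + u - Z u` applies `u` exactly when `Z = -1`. Conjugated by `X` it applies `u`
  -- when `Z = 1`, so the two together apply `u` unconditionally.
  have h := ((Q.preserves_x.mul hc).mul Q.preserves_x).mul hc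
  have e1 : Q.x * (1 + Q.z + u - Q.z * u) * Q.x * (1 + Q.z + u - Q.z * u) = (4 : ℂ) • u := by
    simp only [mul_add, add_mul, mul_sub, sub_mul, mul_assoc, mul_one, one_mul, huu, hx, hz,
      mul_assoc_of_eq hx, mul_assoc_of_eq hz, mul_assoc_of_eq_one huu, Q.xx, Q.zz, Q.zx,
      mul_assoc_of_eq_one Q.xx, mul_assoc_of_eq_one Q.zz, mul_assoc_of_eq_neg Q.zx, mul_neg, neg_mul, neg_neg]
    module
  have e2 : (1 + Q.z + u - Q.z * u) * (Q.x * ((1 + Q.z + u - Q.z * u) * Q.x)) = (4 : ℂ) • u := by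
    simp only [mul_add, add_mul, mul_sub, sub_mul, mul_assoc, mul_one, one_mul, huu, hx, hz,
      mul_assoc_of_eq hx, mul_assoc_of_eq hz, mul_assoc_of_eq_one huu, Q.xx, Q.zz, Q.zx,
      mul_assoc_of_eq_one Q.xx, mul_assoc_of_eq_one Q.zz, mul_assoc_of_eq_neg Q.zx, mul_neg, neg_mul, neg_neg,
      neg_neg]
    module
  rw [e1, e2] at h
  exact h.of_smul (by simp) (by simp)

/-- The controlled gate conjugates `X` to `X u`. It fixes `R` if `u` and `R` commute and sends `R`
to `Z R` if they anticommute. So `X R` becomes `X u R` in the first case and `X Z u R` in the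
second, and either makes `u R` a target. -/
lemma mem_stabilizer_of_controlled {u : A} (huu : u * u = 1)
    (hx : u * Q.x = Q.x * u) (hz : u * Q.z = Q.z * u)
    (hc : Preserves V (1 + Q.z + u - Q.z * u) (1 + Q.z + u - Q.z * u)) : u ∈ Q.stabilizer := by
  have h4 : (4 : ℂ) ≠ 0 := by norm_num
  refine ⟨hx, hz, fun R hR => ?_⟩
  refine mul_mem_targets_of_split huu (preserves_of_controlled huu hx hz hc) hx hz
    (fun _ => True) (fun _ _ => ⟨trivial, trivial⟩) ?_ ?_ hR trivial
  · intro R hR _ hu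
    have := hc _ hR.2.2
    refine ⟨?_, ?_, (V.smul_mem_iff h4).1 ?_⟩
    · simp only [mul_assoc, hR.1, mul_assoc_of_eq hx]
    · simp only [mul_assoc, hR.2.1, mul_assoc_of_eq hz]
    · convert this using 1
      simp only [mul_add, add_mul, mul_sub, sub_mul, mul_assoc, mul_one, one_mul, hx, hz,
        hR.2.1, mul_assoc_of_eq hR.2.1, ← hu, mul_assoc_of_eq hu.symm,
        mul_assoc_of_eq hx, mul_assoc_of_eq hz, mul_assoc_of_eq_one huu,
        mul_assoc_of_eq_one Q.xx, mul_assoc_of_eq_one Q.zz, mul_assoc_of_eq_neg Q.zx, mul_neg, neg_mul, neg_neg]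
      module
  · intro R hR _ hu
    have hu' : R * u = -(u * R) := by rw [hu, neg_neg]
    have := hc _ hR.2.2
    refine targets_of_x_mul_z_mul_mem ?_ ?_ ((V.smul_mem_iff h4).1 ?_)
    · simp only [mul_assoc, hR.1, mul_assoc_of_eq hx]
    · simp only [mul_assoc, hR.2.1, mul_assoc_of_eq hz]
    · convert this using 1
      simp only [mul_add, add_mul, mul_sub, sub_mul, mul_assoc, mul_one, one_mul, hx, hz,
        hR.2.1, mul_assoc_of_eq hR.2.1, hu', mul_assoc_of_eq_neg hu',
        mul_assoc_of_eq hx, mul_assoc_of_eq hz, mul_assoc_of_eq_one huu,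
        mul_assoc_of_eq_one Q.xx, mul_assoc_of_eq_one Q.zz, mul_assoc_of_eq_neg Q.zx, mul_neg, neg_mul, neg_neg]
      module

lemma preserves_of_braid {M : A} (hMM : M * M = 1)
    (hb : Preserves V (1 + Complex.I • M) (1 - Complex.I • M)) : Preserves V M M := by
  have h := hb.mul hb
  have e1 : (1 + Complex.I • M) * (1 + Complex.I • M) = (2 * Complex.I) • M := by
    simp only [mul_add, add_mul, mul_one, one_mul, smul_mul_smul_comm, hMM, Complex.I_mul_I]
    module
  have e2 : (1 - Complex.I • M) * (1 - Complex.I • M) = (-2 * Complex.I) • M := by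
    simp only [mul_sub, sub_mul, mul_one, one_mul, smul_mul_smul_comm, hMM, Complex.I_mul_I]
    module
  rw [e1, e2] at h
  exact h.of_smul (by simp) (by simp)

/-- Braiding conjugates an `R` that anticommutes with `M` to `i M R`, but fixes one that commutes
with `M`. In the latter case `u R` anticommutes with `M`, and `u (M (u R)) = -M R`. -/
lemma mem_stabilizer_of_braid {M u : A} (hMM : M * M = 1)
    (hx : M * Q.x = Q.x * M) (hz : M * Q.z = Q.z * M)
    (hb : Preserves V (1 + Complex.I • M) (1 - Complex.I • M)) (huu : u * u = 1)
    (hu : u ∈ Q.stabilizer) (huM : u * M = -(M * u)) : M ∈ Q.stabilizer := by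
  have h2I : (2 * Complex.I : ℂ) ≠ 0 := mul_ne_zero two_ne_zero Complex.I_ne_zero
  have key : ∀ R ∈ Q.targets, M * R = -(R * M) → M * R ∈ Q.targets := by
    intro R hR hM
    have hM' : R * M = -(M * R) := by rw [hM, neg_neg]
    have := hb _ hR.2.2
    refine ⟨?_, ?_, (V.smul_mem_iff h2I).1 ?_⟩
    · simp only [mul_assoc, hR.1, mul_assoc_of_eq hx]
    · simp only [mul_assoc, hR.2.1, mul_assoc_of_eq hz]
    · convert this using 1
      simp only [add_mul, mul_sub, mul_assoc, mul_one, one_mul, smul_mul_assoc,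
        mul_smul_comm, hM', mul_assoc_of_eq hx, mul_assoc_of_eq_one hMM, mul_neg, neg_mul, neg_neg, smul_smul,
        Complex.I_mul_I, smul_neg, smul_sub, smul_add]
      module
  refine ⟨hx, hz, fun R hR => ?_⟩
  refine mul_mem_targets_of_split hMM (preserves_of_braid hMM hb) hx hz
    (fun _ => True) (fun _ _ => ⟨trivial, trivial⟩) ?_ (fun R hR _ hM => key R hR hM) hR trivial
  intro R hR _ hM
  have h1 := hu.2.2 _ (key _ (hu.2.2 R hR) (by
    rw [← mul_assoc, show M * u = -(u * M) by rw [huM, neg_neg], neg_mul, mul_assoc, mul_assoc,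
      hM]))
  rw [show u * (M * (u * R)) = -(M * R) by
    rw [mul_assoc_of_eq_neg huM, mul_assoc_of_eq_one huu]] at h1
  exact neg_mem_iff.1 h1

/-- Another qubit, with Pauli operator `w`, coupled by the gate `controlled-u`. -/
lemma mem_stabilizer_of_qubit {M u w : A} (hMM : M * M = 1) (huu : u * u = 1) (hww : w * w = 1)
    (hx : w * Q.x = Q.x * w) (hz : w * Q.z = Q.z * w) (hu : u ∈ Q.stabilizer)
    (hM : M ∈ Q.stabilizer) (huM : u * M = -(M * u)) (hwu : w * u = u * w) (hwM : w * M = M * w)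
    (hw : Preserves V w w) (hu' : Preserves V u u)
    (hd : Preserves V (1 + w + u - w * u) (1 + w + u - w * u)) : w ∈ Q.stabilizer := by
  have h4 : (4 : ℂ) ≠ 0 := by norm_num
  have h4' : (-4 : ℂ) ≠ 0 := by norm_num
  have hwR : ∀ R ∈ Q.targets, (w * R) * Q.x = Q.x * (w * R) := fun R hR => by
    simp only [mul_assoc, hR.1, mul_assoc_of_eq hx]
  have hwR' : ∀ R ∈ Q.targets, (w * R) * Q.z = Q.z * (w * R) := fun R hR => by
    simp only [mul_assoc, hR.2.1, mul_assoc_of_eq hz]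
  have hux := hu.1
  have huz := hu.2.1
  -- The gate coupling `w` and `u` is symmetric: it multiplies by `w` an operator anticommuting with
  -- `u` alone, and by `u w`, up to sign, one anticommuting with both. In the second case the extra
  -- `u` is removed inside the stabilizer.
  have key1 : ∀ R ∈ Q.targets, w * R = R * w → u * R = -(R * u) → w * R ∈ Q.targets := by
    intro R hR h1 h2
    have h2' : R * u = -(u * R) := by rw [h2, neg_neg]
    have := hd _ hR.2.2
    refine ⟨hwR R hR, hwR' R hR, (V.smul_mem_iff h4).1 ?_⟩
    convert this using 1
    simp only [mul_add, add_mul, mul_sub, sub_mul, mul_assoc, mul_one, one_mul, hwu, ← h1, h2',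
      mul_assoc_of_eq h1.symm, mul_assoc_of_eq_neg h2', mul_assoc_of_eq hwu, mul_assoc_of_eq hx,
      mul_assoc_of_eq hux, mul_assoc_of_eq_one huu, mul_assoc_of_eq_one hww, mul_neg, neg_mul, neg_neg]
    module
  have key2 : ∀ R ∈ Q.targets, w * R = -(R * w) → u * R = -(R * u) → w * R ∈ Q.targets := by
    intro R hR h1 h2
    have h1' : R * w = -(w * R) := by rw [h1, neg_neg]
    have h2' : R * u = -(u * R) := by rw [h2, neg_neg]
    have := hd _ hR.2.2
    have hmem : u * (w * R) ∈ Q.targets := by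
      refine ⟨?_, ?_, (V.smul_mem_iff h4').1 ?_⟩
      · simp only [mul_assoc, hR.1, mul_assoc_of_eq hx, mul_assoc_of_eq hux]
      · simp only [mul_assoc, hR.2.1, mul_assoc_of_eq hz, mul_assoc_of_eq huz]
      · convert this using 1
        simp only [mul_add, add_mul, mul_sub, sub_mul, mul_assoc, mul_one, one_mul, hwu, h1', h2',
          mul_assoc_of_eq_neg h1', mul_assoc_of_eq_neg h2', mul_assoc_of_eq hwu,
          mul_assoc_of_eq hx, mul_assoc_of_eq hux, mul_assoc_of_eq_one huu,
          mul_assoc_of_eq_one hww, mul_neg, neg_mul, neg_neg]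
        module
    have := hu.2.2 _ hmem
    rwa [mul_assoc_of_eq_one huu] at this
  -- If `R` commutes with `u`, then `M R` anticommutes with it, and `M` can be undone afterwards.
  have lift : ∀ R ∈ Q.targets, u * R = R * u → w * (M * R) ∈ Q.targets → w * R ∈ Q.targets := by
    intro R hR h2 h
    have := hM.2.2 _ h
    rwa [mul_assoc_of_eq hwM, mul_assoc_of_eq_one hMM] at this
  have anti : ∀ R : A, u * R = R * u → u * (M * R) = -(M * R * u) := fun R h => by
    rw [mul_assoc_of_eq_neg huM, h, mul_assoc]
  have hsplit : ∀ (ε : ℂ) (R : A), w * R = ε • (R * w) →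
      w * (R + u * R * u) = ε • ((R + u * R * u) * w)
        ∧ w * (R - u * R * u) = ε • ((R - u * R * u) * w) := by
    intro ε R h
    have : w * (u * R * u) = ε • (u * R * u * w) := by
      simp only [mul_assoc, ← hwu]
      rw [mul_assoc_of_eq hwu, ← mul_assoc w R, h, smul_mul_assoc, mul_smul_comm, mul_assoc]
    exact ⟨by rw [mul_add, add_mul, smul_add, h, this], by rw [mul_sub, sub_mul, smul_sub, h, this]⟩
  refine ⟨hx, hz, fun R hR => ?_⟩
  refine mul_mem_targets_of_split hww hw hx hz
    (fun _ => True) (fun _ _ => ⟨trivial, trivial⟩) ?_ ?_ hR trivial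
  · intro R hR _ h1
    refine mul_mem_targets_of_split huu hu' hux huz (fun R => w * R = (1 : ℂ) • (R * w))
      (hsplit 1) ?_ ?_ hR (by rw [one_smul, h1])
    · intro R hR h1 h2
      rw [one_smul] at h1
      exact lift R hR h2 (key1 _ (hM.2.2 R hR) (by
        rw [mul_assoc_of_eq hwM, h1, mul_assoc]) (anti R h2))
    · intro R hR h1 h2
      rw [one_smul] at h1
      exact key1 R hR h1 h2
  · intro R hR _ h1
    refine mul_mem_targets_of_split huu hu' hux huz (fun R => w * R = (-1 : ℂ) • (R * w))
      (hsplit (-1)) ?_ ?_ hR (by rw [neg_one_smul, h1])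
    · intro R hR h1 h2
      rw [neg_one_smul] at h1
      exact lift R hR h2 (key2 _ (hM.2.2 R hR) (by
        rw [mul_assoc_of_eq hwM, h1, mul_neg, mul_assoc]) (anti R h2))
    · intro R hR h1 h2
      rw [neg_one_smul] at h1
      exact key2 R hR h1 h2

/-- The Pauli operator `v` obtained from `w` by a Hadamard gate. -/
lemma mem_stabilizer_of_hadamard {v w : A} (hvv : v * v = 1) (hww : w * w = 1)
    (hwv : w * v = -(v * w)) (hx : v * Q.x = Q.x * v) (hz : v * Q.z = Q.z * v)
    (hw : w ∈ Q.stabilizer) (hh : Preserves V (v + w) (v + w)) : v ∈ Q.stabilizer := by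
  refine ⟨hx, hz, fun R hR => ?_⟩
  have hhx : (v + w) * Q.x = Q.x * (v + w) := by rw [add_mul, mul_add, hx, hw.1]
  have hhz : (v + w) * Q.z = Q.z * (v + w) := by rw [add_mul, mul_add, hz, hw.2.1]
  -- Conjugating by the Hadamard gate before and after multiplication by `w` amounts to
  -- multiplication by `v`.
  have h1 := targets_conj hh hhx hhz hhx hhz hR
  have h2 := targets_conj hh hhx hhz hhx hhz (hw.2.2 _ h1)
  refine (Q.targets.smul_mem_iff (show (4 : ℂ) ≠ 0 by norm_num)).1 ?_
  convert h2 using 1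
  simp only [mul_add, add_mul, mul_assoc, hvv, hww, hwv, mul_assoc_of_eq_one hvv,
    mul_assoc_of_eq_one hww, mul_assoc_of_eq_neg hwv, mul_neg, neg_mul, neg_neg, mul_one]
  module

end ControlQubit

end Control

/-! ### Signs, shifts of configurations and diagonal operators -/

/-- The character `(-1)^a` of a bit. -/
def bitSign (a : Fin 2) : ℂ := if a = 0 then 1 else -1

@[simp] lemma bitSign_zero : bitSign 0 = 1 := rfl

@[simp] lemma bitSign_one : bitSign 1 = -1 := rfl

lemma bitSign_add (a b : Fin 2) : bitSign (a + b) = bitSign a * bitSign b := by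
  fin_cases a <;> fin_cases b <;> simp [bitSign]

lemma bitSign_mul_self (a : Fin 2) : bitSign a * bitSign a = 1 := by
  fin_cases a <;> simp [bitSign]

lemma star_bitSign (a : Fin 2) : star (bitSign a) = bitSign a := by
  fin_cases a <;> simp [bitSign]

lemma bit_add_self (a : Fin 2) : a + a = 0 := by
  fin_cases a <;> rfl

variable {q f : ℕ}

lemma conf_add_self (v : Conf q f) : v + v = 0 := by
  ext k <;> simp [bit_add_self]

lemma conf_eq_add_iff (c d v : Conf q f) : c = d + v ↔ d = c + v := by
  constructor <;> rintro rfl <;> rw [add_assoc, conf_add_self, add_zero]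

/-- The operator that flips the bits in `v`. -/
def shift (v : Conf q f) : Op q f := fun c d => if c = d + v then 1 else 0

lemma shift_zero : (shift 0 : Op q f) = 1 := by
  ext c d
  simp [shift, Matrix.one_apply]

lemma shift_mul_apply (v : Conf q f) (M : Op q f) (c d : Conf q f) :
    (shift v * M) c d = M (c + v) d := by
  rw [Matrix.mul_apply, Finset.sum_eq_single (c + v)]
  · rw [shift, if_pos (by rw [add_assoc, conf_add_self, add_zero]), one_mul]
  · intro b _ hb
    rw [shift, if_neg (fun h => hb ((conf_eq_add_iff c b v).1 h)), zero_mul]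
  · simp

lemma shift_mul_shift (v w : Conf q f) : shift v * shift w = (shift (v + w) : Op q f) := by
  ext c d
  rw [shift_mul_apply]
  have : c + v = d + w ↔ c = d + (v + w) := by
    constructor
    · intro h
      have h2 : c = d + w + v := by rw [← h, add_assoc, conf_add_self, add_zero]
      rw [h2]; abel
    · rintro rfl
      rw [show d + (v + w) + v = d + w + (v + v) by abel, conf_add_self, add_zero]
  simp only [shift, this]

lemma shift_mul_self (v : Conf q f) : shift v * shift v = (1 : Op q f) := by
  rw [shift_mul_shift, conf_add_self, shift_zero]

lemma star_shift (v : Conf q f) : star (shift v : Op q f) = shift v := by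
  ext c d
  simp only [Matrix.star_apply, shift, conf_eq_add_iff d c v]
  split_ifs <;> simp

/-- The rule that brings every product of elementary operators to the normal form shift times
diagonal. -/
lemma diagonal_mul_shift (h : Conf q f → ℂ) (v : Conf q f) :
    Matrix.diagonal h * shift v = (shift v * Matrix.diagonal fun d => h (d + v) : Op q f) := by
  ext c d
  rw [shift_mul_apply, Matrix.diagonal_mul, shift, Matrix.diagonal_apply]
  by_cases hc : c = d + v
  · subst hc
    simp [add_assoc, conf_add_self]
  · have : c + v ≠ d := fun h => hc ((conf_eq_add_iff c d v).2 h.symm)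
    simp [hc, this]

/-- Pauli `X` on a qubit. -/
def pauliX (i : Fin q) : Op q f := shift (Pi.single i 1, 0)

/-- Pauli `Z` on a qubit. -/
def pauliZ (i : Fin q) : Op q f := Matrix.diagonal fun c => bitSign (c.1 i)

/-- The parity `(-1)^{n_j}` of a site. -/
def siteZ (j : Fin f) : Op q f := Matrix.diagonal fun c => bitSign (c.2 j)

/-- The configuration in which only site `j` is occupied. -/
def siteFlip (j : Fin f) : Conf q f := (0, Pi.single j 1)

lemma star_diagonal_of_real {h : Conf q f → ℂ} (hh : ∀ c, star (h c) = h c) :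
    star (Matrix.diagonal h : Op q f) = Matrix.diagonal h := by
  rw [Matrix.star_eq_conjTranspose, Matrix.diagonal_conjTranspose]
  congr 1
  funext c
  exact hh c

lemma diagonal_mul_self_of_sq {h : Conf q f → ℂ} (hh : ∀ c, h c * h c = 1) :
    (Matrix.diagonal h * Matrix.diagonal h : Op q f) = 1 := by
  rw [Matrix.diagonal_mul_diagonal, ← Matrix.diagonal_one]
  congr 1
  funext c
  exact hh c

lemma diagonal_commute (g h : Conf q f → ℂ) :
    (Matrix.diagonal g * Matrix.diagonal h : Op q f) = Matrix.diagonal h * Matrix.diagonal g := by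
  simp only [Matrix.diagonal_mul_diagonal, mul_comm]

lemma pauliX_mul_self (i : Fin q) : (pauliX i * pauliX i : Op q f) = 1 := shift_mul_self _

lemma pauliZ_mul_self (i : Fin q) : (pauliZ i * pauliZ i : Op q f) = 1 :=
  diagonal_mul_self_of_sq fun _ => bitSign_mul_self _

lemma siteZ_mul_self (j : Fin f) : (siteZ j * siteZ j : Op q f) = 1 :=
  diagonal_mul_self_of_sq fun _ => bitSign_mul_self _

lemma star_pauliX (i : Fin q) : star (pauliX i : Op q f) = pauliX i := star_shift _

lemma star_pauliZ (i : Fin q) : star (pauliZ i : Op q f) = pauliZ i :=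
  star_diagonal_of_real fun _ => star_bitSign _

lemma star_siteZ (j : Fin f) : star (siteZ j : Op q f) = siteZ j :=
  star_diagonal_of_real fun _ => star_bitSign _

lemma pauliZ_mul_pauliX (i : Fin q) : (pauliZ i * pauliX i : Op q f) = -(pauliX i * pauliZ i) := by
  rw [pauliZ, pauliX, diagonal_mul_shift, ← mul_neg, Matrix.diagonal_neg]
  congr 2
  funext d
  simp [bitSign_add]

/-! ### Jordan–Wigner signs -/

/-- The Jordan–Wigner sign of site `j`. -/
def jwSign (j : Fin f) (s : Fin f → Fin 2) : ℂ := ∏ k, if j < k then bitSign (s k) else 1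

lemma jwSign_add (j : Fin f) (s t : Fin f → Fin 2) :
    jwSign j (s + t) = jwSign j s * jwSign j t := by
  rw [jwSign, jwSign, jwSign, ← Finset.prod_mul_distrib]
  refine Finset.prod_congr rfl fun k _ => ?_
  split_ifs
  · exact bitSign_add _ _
  · simp

lemma jwSign_mul_self (j : Fin f) (s : Fin f → Fin 2) : jwSign j s * jwSign j s = 1 := by
  rw [← jwSign_add]
  refine Finset.prod_eq_one fun k _ => ?_
  simp [bit_add_self]

lemma star_jwSign (j : Fin f) (s : Fin f → Fin 2) : star (jwSign j s) = jwSign j s := by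
  rw [jwSign, star_prod]
  refine Finset.prod_congr rfl fun k _ => ?_
  split_ifs
  · exact star_bitSign _
  · simp

lemma jwSign_single (i j : Fin f) : jwSign j (Pi.single i 1) = if j < i then -1 else 1 := by
  rw [jwSign, Finset.prod_eq_single i]
  · simp
  · intro k _ hk
    simp [Pi.single_eq_of_ne hk]
  · simp

lemma neg_one_pow_card (j : Fin f) (s : Fin f → Fin 2) :
    (-1 : ℂ) ^ (Finset.univ.filter fun k : Fin f => j < k ∧ s k = 1).card = jwSign j s := by
  rw [← Finset.prod_const, Finset.prod_filter]
  refine Finset.prod_congr rfl fun k _ => ?_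
  by_cases hk : j < k
  · have : s k = 0 ∨ s k = 1 := by omega
    rcases this with h | h <;> simp [hk, h]
  · simp [hk]

/-! ### Fermionic operators -/

lemma ann_eq (j : Fin f) : (ann j : Op q f)
    = shift (siteFlip j) * Matrix.diagonal fun d => if d.2 j = 1 then jwSign j d.2 else 0 := by
  ext c d
  rw [shift_mul_apply, Matrix.diagonal_apply, ann, neg_one_pow_card]
  by_cases hd : d.2 j = 1
  · have : (c.1 = d.1 ∧ d.2 j = 1 ∧ c.2 = Function.update d.2 j 0) ↔ c + siteFlip j = d := by
      have hu : Function.update d.2 j 0 = d.2 + Pi.single j 1 := by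
        funext k
        by_cases hk : k = j
        · subst hk; simp [hd]
        · simp [hk]
      rw [eq_comm (a := c + siteFlip j), ← conf_eq_add_iff, hu, Prod.ext_iff]
      simp [siteFlip, hd]
    by_cases h : c + siteFlip j = d
    · rw [if_pos (this.2 h), if_pos h, h, if_pos hd]
    · rw [if_neg (fun h' => h (this.1 h')), if_neg h]
  · rw [if_neg (fun h => hd h.2.1)]
    split_ifs with h1 h2
    · rw [h1] at h2; exact absurd h2 hd
    · rfl
    · rfl

lemma jwSign_add_siteFlip_self (j : Fin f) (d : Conf q f) :
    jwSign j (d + siteFlip j).2 = jwSign j d.2 := by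
  rw [Prod.snd_add, jwSign_add, siteFlip, jwSign_single]
  simp

lemma cre_eq (j : Fin f) : (cre j : Op q f)
    = shift (siteFlip j) * Matrix.diagonal fun d => if d.2 j = 0 then jwSign j d.2 else 0 := by
  rw [cre, ann_eq, Matrix.conjTranspose_mul, ← Matrix.star_eq_conjTranspose (shift _), star_shift,
    Matrix.diagonal_conjTranspose, diagonal_mul_shift]
  congr 2
  funext d
  have h : d.2 j = 0 ∨ d.2 j = 1 := by omega
  simp only [Pi.star_apply, jwSign_add_siteFlip_self]
  rcases h with h | h <;> simp [siteFlip, h, ← Complex.star_def, star_jwSign]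

lemma num_eq (j : Fin f) :
    (num j : Op q f) = Matrix.diagonal fun d => if d.2 j = 1 then 1 else 0 := by
  have h : (cre j : Op q f) = (Matrix.diagonal fun d => if d.2 j = 1 then jwSign j d.2 else 0)
      * shift (siteFlip j) := by
    rw [cre_eq, diagonal_mul_shift]
    congr 2
    funext d
    have h : d.2 j = 0 ∨ d.2 j = 1 := by omega
    rw [jwSign_add_siteFlip_self]
    rcases h with h | h <;> simp [siteFlip, h]
  rw [num, h, ann_eq, mul_assoc, ← mul_assoc (shift _), shift_mul_self, one_mul,
    Matrix.diagonal_mul_diagonal]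
  congr 1
  funext d
  split_ifs
  · exact jwSign_mul_self _ _
  · simp

/-- The product `(p_i† - p_i) (p_j† + p_j)` of Majorana operators. -/
def majoranaPair (i j : Fin f) : Op q f := (cre i - ann i) * (cre j + ann j)

/-- The sign of the basis vectors under `majoranaPair i j`. -/
def majoranaSign (i j : Fin f) (s : Fin f → Fin 2) : ℂ :=
  jwSign i (s + Pi.single j 1) * bitSign (s i) * jwSign j s

lemma majoranaPair_eq {i j : Fin f} (hij : i ≠ j) : (majoranaPair i j : Op q f)
    = shift (siteFlip i + siteFlip j) * Matrix.diagonal fun d => majoranaSign i j d.2 := by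
  have h1 : (cre i - ann i : Op q f)
      = shift (siteFlip i) * Matrix.diagonal fun d => jwSign i d.2 * bitSign (d.2 i) := by
    rw [cre_eq, ann_eq, ← mul_sub, Matrix.diagonal_sub]
    congr 2
    funext d
    have h : d.2 i = 0 ∨ d.2 i = 1 := by omega
    rcases h with h | h <;> simp [h]
  have h2 : (cre j + ann j : Op q f)
      = shift (siteFlip j) * Matrix.diagonal fun d => jwSign j d.2 := by
    rw [cre_eq, ann_eq, ← mul_add, Matrix.diagonal_add]
    congr 2
    funext d
    have h : d.2 j = 0 ∨ d.2 j = 1 := by omega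
    rcases h with h | h <;> simp [h]
  rw [majoranaPair, h1, h2, mul_assoc, ← mul_assoc (Matrix.diagonal _), diagonal_mul_shift,
    ← shift_mul_shift, mul_assoc, mul_assoc, Matrix.diagonal_mul_diagonal]
  congr 3
  funext d
  simp [majoranaSign, siteFlip, Pi.single_eq_of_ne hij]

lemma majoranaSign_mul_self (i j : Fin f) (s : Fin f → Fin 2) :
    majoranaSign i j s * majoranaSign i j s = 1 := by
  rw [majoranaSign, show ∀ a b c : ℂ, a * b * c * (a * b * c) = (a * a) * (b * b) * (c * c) by
    intros; ring, jwSign_mul_self, jwSign_mul_self, bitSign_mul_self]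
  simp

lemma star_majoranaSign (i j : Fin f) (s : Fin f → Fin 2) :
    star (majoranaSign i j s) = majoranaSign i j s := by
  rw [majoranaSign, star_mul', star_mul', star_jwSign, star_jwSign, star_bitSign]

/-- Flipping both sites changes the sign of `bitSign (s i)` and of exactly one of the two
Jordan–Wigner factors, namely that of the smaller index. -/
lemma majoranaSign_add {i j : Fin f} (hij : i ≠ j) (s : Fin f → Fin 2) :
    majoranaSign i j (s + (Pi.single i 1 + Pi.single j 1)) = majoranaSign i j s := by
  simp only [majoranaSign, jwSign_add, bitSign_add, Pi.add_apply, Pi.single_eq_same,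
    Pi.single_eq_of_ne hij, jwSign_single, lt_self_iff_false, if_false]
  rcases lt_or_gt_of_ne hij with h | h <;> simp [h, h.not_gt]

lemma majoranaPair_mul_self {i j : Fin f} (hij : i ≠ j) :
    (majoranaPair i j * majoranaPair i j : Op q f) = 1 := by
  rw [majoranaPair_eq hij, mul_assoc, ← mul_assoc (Matrix.diagonal _), diagonal_mul_shift,
    mul_assoc, ← mul_assoc, shift_mul_self, one_mul, Matrix.diagonal_mul_diagonal,
    ← Matrix.diagonal_one]
  congr 1
  funext d
  have e : (d + (siteFlip i + siteFlip j) : Conf q f).2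
      = d.2 + (Pi.single i 1 + Pi.single j 1) := rfl
  rw [e, majoranaSign_add hij, majoranaSign_mul_self]

lemma star_majoranaPair {i j : Fin f} (hij : i ≠ j) :
    star (majoranaPair i j : Op q f) = majoranaPair i j := by
  rw [majoranaPair_eq hij, star_mul, star_shift,
    star_diagonal_of_real fun c => star_majoranaSign _ _ _, diagonal_mul_shift]
  congr 2
  funext d
  exact majoranaSign_add hij _

lemma majoranaPair_commute_diagonal {i j : Fin f} (hij : i ≠ j) {h : Conf q f → ℂ}
    (hh : ∀ d, h (d + (siteFlip i + siteFlip j)) = h d) :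
    majoranaPair i j * Matrix.diagonal h = Matrix.diagonal h * majoranaPair i j := by
  rw [majoranaPair_eq hij, ← mul_assoc, diagonal_mul_shift, mul_assoc, mul_assoc, diagonal_commute]
  simp only [hh]

lemma majoranaPair_commute_pauliX {i j : Fin f} (hij : i ≠ j) (k : Fin q) :
    (majoranaPair i j * pauliX k : Op q f) = pauliX k * majoranaPair i j := by
  rw [majoranaPair_eq hij, pauliX, mul_assoc, diagonal_mul_shift, ← mul_assoc, ← mul_assoc,
    shift_mul_shift, shift_mul_shift, add_comm]
  simp

lemma siteZ_mul_majoranaPair {i j : Fin f} (hij : i ≠ j) :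
    (siteZ i * majoranaPair i j : Op q f) = -(majoranaPair i j * siteZ i) := by
  rw [majoranaPair_eq hij, siteZ, ← mul_assoc, diagonal_mul_shift, mul_assoc, mul_assoc,
    ← mul_neg, Matrix.diagonal_mul_diagonal, Matrix.diagonal_mul_diagonal, Matrix.diagonal_neg]
  congr 2
  funext d
  simp [bitSign_add, siteFlip, Pi.single_eq_of_ne hij, mul_comm]

lemma siteZ_commute_pauliX (j : Fin f) (k : Fin q) :
    (siteZ j * pauliX k : Op q f) = pauliX k * siteZ j := by
  rw [siteZ, pauliX, diagonal_mul_shift]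
  simp

lemma pauliZ_commute_pauliX {i k : Fin q} (hik : i ≠ k) :
    (pauliZ i * pauliX k : Op q f) = pauliX k * pauliZ i := by
  rw [pauliZ, pauliX, diagonal_mul_shift]
  simp [Pi.single_eq_of_ne hik]

lemma pauliX_commute (i k : Fin q) : (pauliX i * pauliX k : Op q f) = pauliX k * pauliX i := by
  rw [pauliX, pauliX, shift_mul_shift, shift_mul_shift, add_comm]

/-! ### Formulas for the gates -/

lemma onQubit_diag (a b : ℂ) (i : Fin q) :
    (onQubit !![a, 0; 0, b] i : Op q f) = Matrix.diagonal fun c => if c.1 i = 0 then a else b := by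
  ext c d
  rw [onQubit, Matrix.diagonal_apply]
  by_cases h : c = d
  · subst h
    have : c.1 i = 0 ∨ c.1 i = 1 := by omega
    rcases this with h | h <;> simp [h]
  · rw [if_neg h]
    split_ifs with h'
    · have hne : c.1 i ≠ d.1 i := by
        intro he
        apply h
        refine Prod.ext (funext fun k => ?_) h'.2
        by_cases hk : k = i
        · rw [hk, he]
        · exact h'.1 k hk
      have hc : c.1 i = 0 ∨ c.1 i = 1 := by omega
      have hd : d.1 i = 0 ∨ d.1 i = 1 := by omega
      rcases hc with hc | hc <;> rcases hd with hd | hd <;> simp_all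
    · rfl

lemma onQubit_phase (a : ℂ) (i : Fin q) :
    (onQubit !![1, 0; 0, a] i : Op q f) = ((1 + a) / 2) • 1 + ((1 - a) / 2) • pauliZ i := by
  rw [onQubit_diag, pauliZ, ← Matrix.diagonal_one, ← Matrix.diagonal_smul, ← Matrix.diagonal_smul,
    Matrix.diagonal_add]
  congr 1
  funext c
  have : c.1 i = 0 ∨ c.1 i = 1 := by omega
  rcases this with h | h <;> simp [h] <;> ring

lemma gateS_eq (i : Fin q) : (gateS i : Op q f)
    = ((1 + Complex.I) / 2) • 1 + ((1 - Complex.I) / 2) • pauliZ i := onQubit_phase _ _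

lemma gateT_eq (i : Fin q) : (gateT i : Op q f)
    = ((1 + Complex.exp (Complex.I * ((Real.pi : ℂ) / 4))) / 2) • 1
      + ((1 - Complex.exp (Complex.I * ((Real.pi : ℂ) / 4))) / 2) • pauliZ i := onQubit_phase _ _

lemma gateH_eq (i : Fin q) :
    (gateH i : Op q f) = (((Real.sqrt 2 : ℝ) : ℂ)⁻¹) • (pauliX i + pauliZ i) := by
  ext c d
  change onQubit _ i c d = ((Real.sqrt 2 : ℝ) : ℂ)⁻¹ * ((shift (Pi.single i 1, 0) : Op q f) c d
    + (Matrix.diagonal (fun c => bitSign (c.1 i)) : Op q f) c d)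
  rw [onQubit, shift, Matrix.diagonal_apply]
  have hc : c.1 i = 0 ∨ c.1 i = 1 := by omega
  have hd : d.1 i = 0 ∨ d.1 i = 1 := by omega
  by_cases h : (∀ k, k ≠ i → c.1 k = d.1 k) ∧ c.2 = d.2
  · rw [if_pos h]
    by_cases he : c.1 i = d.1 i
    · have hcd : c = d := by
        refine Prod.ext (funext fun k => ?_) h.2
        by_cases hk : k = i
        · rw [hk, he]
        · exact h.1 k hk
      subst hcd
      have hne : ¬ c = c + (Pi.single i 1, 0) := fun h => by
        have := congrFun (congrArg Prod.fst h) i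
        simp at this
      rw [if_neg hne, if_pos rfl]
      rcases hc with hc | hc <;> simp [hc]
    · have hcd : c = d + (Pi.single i 1, 0) := by
        refine Prod.ext (funext fun k => ?_) (by simpa using h.2)
        by_cases hk : k = i
        · subst hk
          rcases hc with hc | hc <;> rcases hd with hd | hd <;> simp_all
        · simpa [hk] using h.1 k hk
      have hne : c ≠ d := fun h => he (by rw [h])
      rw [if_pos hcd, if_neg hne]
      rcases hc with hc | hc <;> rcases hd with hd | hd <;> simp_all
  · rw [if_neg h, if_neg, if_neg]
    · simp
    · rintro rfl; exact h ⟨fun _ _ => rfl, rfl⟩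
    · rintro rfl
      exact h ⟨fun k hk => by simp [hk], by simp⟩

lemma exp_smul_diagonal (a : ℂ) (h : Conf q f → ℂ) :
    exp (a • (Matrix.diagonal h : Op q f)) = Matrix.diagonal fun c => Complex.exp (a * h c) := by
  rw [← Matrix.diagonal_smul, Matrix.exp_diagonal]
  congr 1
  funext c
  rw [Pi.coe_exp, Complex.exp_eq_exp_ℂ]
  rfl

lemma gateTf_eq (j : Fin f) : (gateTf j : Op q f)
    = ((1 + Complex.exp (Complex.I * ((Real.pi : ℂ) / 4))) / 2) • 1
      + ((1 - Complex.exp (Complex.I * ((Real.pi : ℂ) / 4))) / 2) • siteZ j := by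
  rw [gateTf, num_eq, exp_smul_diagonal, siteZ, ← Matrix.diagonal_one, ← Matrix.diagonal_smul,
    ← Matrix.diagonal_smul, Matrix.diagonal_add]
  congr 1
  funext c
  have : c.2 j = 0 ∨ c.2 j = 1 := by omega
  rcases this with h | h <;> simp [h] <;> ring

lemma gateCZqf_eq (i : Fin q) (j : Fin f) : (gateCZqf i j : Op q f)
    = (2⁻¹ : ℂ) • (1 + pauliZ i + siteZ j - pauliZ i * siteZ j) := by
  rw [gateCZqf, num_eq, qubitNum, onQubit_diag, Matrix.diagonal_mul_diagonal, exp_smul_diagonal,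
    pauliZ, siteZ, ← Matrix.diagonal_one, Matrix.diagonal_mul_diagonal, Matrix.diagonal_add,
    Matrix.diagonal_add, Matrix.diagonal_sub, ← Matrix.diagonal_smul]
  congr 1
  funext c
  have h1 : c.1 i = 0 ∨ c.1 i = 1 := by omega
  have h2 : c.2 j = 0 ∨ c.2 j = 1 := by omega
  have he : Complex.exp (Complex.I * Real.pi) = -1 := by rw [mul_comm, Complex.exp_pi_mul_I]
  rcases h1 with h1 | h1 <;> rcases h2 with h2 | h2 <;> simp [h1, h2, he] <;> norm_num

lemma parity_eq : parity q f = Matrix.diagonal fun c => bitSign (∑ j, c.2 j) := by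
  have : ∀ T : Finset (Fin f), (∑ j ∈ T, (num j : Op q f))
      = Matrix.diagonal fun d => ∑ j ∈ T, if d.2 j = 1 then 1 else 0 := by
    intro T
    induction T using Finset.induction_on with
    | empty => simp
    | insert j T hj ih =>
      simp only [Finset.sum_insert hj]
      rw [ih, num_eq, Matrix.diagonal_add]
  rw [parity, this, exp_smul_diagonal]
  congr 1
  funext c
  rw [Finset.mul_sum, Complex.exp_sum]
  have hb : ∀ T : Finset (Fin f), bitSign (∑ j ∈ T, c.2 j) = ∏ j ∈ T, bitSign (c.2 j) := by
    intro T
    induction T using Finset.induction_on with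
    | empty => simp
    | insert j T hj ih => rw [Finset.sum_insert hj, Finset.prod_insert hj, bitSign_add, ih]
  rw [hb]
  refine Finset.prod_congr rfl fun j _ => ?_
  have h2 : c.2 j = 0 ∨ c.2 j = 1 := by omega
  have he : Complex.exp (Complex.I * Real.pi) = -1 := by rw [mul_comm, Complex.exp_pi_mul_I]
  rcases h2 with h2 | h2 <;> simp [h2, he]

open scoped Matrix.Norms.L2Operator in
lemma gateBraid_eq {i j : Fin f} (hij : i ≠ j) : (gateBraid i j : Op q f)
    = ((√2 / 2 : ℝ) : ℂ) • (1 + Complex.I • majoranaPair i j) := by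
  have h := exp_smul_involution (majoranaPair_mul_self (q := q) hij) ((Real.pi : ℂ) / 4)
  have h1 : Complex.cos ((Real.pi : ℂ) / 4) = ((√2 / 2 : ℝ) : ℂ) := by
    rw [← Real.cos_pi_div_four]; push_cast; rfl
  have h2 : Complex.sin ((Real.pi : ℂ) / 4) = ((√2 / 2 : ℝ) : ℂ) := by
    rw [← Real.sin_pi_div_four]; push_cast; rfl
  rw [h1, h2] at h
  refine h.trans ?_
  module

/-! ### Clifford conjugations and the stabilizer of a qubit -/

section Circuits

open scoped Matrix.Norms.L2Operator

variable {q f : ℕ} {C : Submonoid (Op q f)} {hC : IsClosed (C : Set (Op q f))}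

lemma preserves_of_finite_order {A : Type*} [CStarAlgebra A] {C : Submonoid A}
    {hC : IsClosed (C : Set A)} {g : A} (hu : g ∈ unitary A) (hg : g ∈ C) {n : ℕ}
    (hn : g ^ (n + 1) = 1) : Preserves (complexGenerators C hC) g (star g) :=
  (mem_normalizer_of_mem hu hg (star_mem_of_pow_eq_one hu hg hn)).2

lemma preserves_of_involution {A : Type*} [CStarAlgebra A] {C : Submonoid A}
    {hC : IsClosed (C : Set A)} {g : A} (hs : star g = g) (hg : g ∈ C) (hn : g * g = 1) :
    Preserves (complexGenerators C hC) g g := by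
  have := preserves_of_finite_order (hC := hC) (n := 1)
    (Unitary.mem_iff.2 ⟨by rw [hs, hn], by rw [hs, hn]⟩) hg (by rw [pow_succ, pow_one, hn])
  rwa [hs] at this

lemma preserves_hadamard (hG : ∀ g, CliffordGate q f g → g ∈ C) (i : Fin q) :
    Preserves (complexGenerators C hC) (pauliX i + pauliZ i) (pauliX i + pauliZ i) := by
  have hg := hG _ (CliffordGate.h i)
  have h0 : (((Real.sqrt 2 : ℝ) : ℂ)⁻¹) ≠ 0 := by
    rw [ne_eq, inv_eq_zero, Complex.ofReal_eq_zero]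
    exact Real.sqrt_ne_zero'.2 two_pos
  have h2 : (((Real.sqrt 2 : ℝ) : ℂ)⁻¹) * (((Real.sqrt 2 : ℝ) : ℂ)⁻¹) = 2⁻¹ := by
    rw [← mul_inv, ← Complex.ofReal_mul, Real.mul_self_sqrt two_pos.le]
    norm_num
  rw [gateH_eq] at hg
  refine Preserves.of_smul h0 h0 (preserves_of_involution ?_ hg ?_)
  · rw [star_smul, star_add, star_pauliX, star_pauliZ, star_inv₀, Complex.star_def,
      Complex.conj_ofReal]
  · rw [smul_mul_smul_comm, h2, mul_add, add_mul, add_mul, pauliX_mul_self, pauliZ_mul_self,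
      pauliZ_mul_pauliX]
    module

/-- The square of the phase gate is the involution `z`. -/
lemma phase_pow_four {A : Type*} [Ring A] [Algebra ℂ A] {z : A} (hz : z * z = 1) :
    (((1 + Complex.I) / 2) • 1 + ((1 - Complex.I) / 2) • z) ^ 4 = 1 := by
  have : (((1 + Complex.I) / 2) • 1 + ((1 - Complex.I) / 2) • z)
      * (((1 + Complex.I) / 2) • 1 + ((1 - Complex.I) / 2) • z) = z := by
    simp only [mul_add, add_mul, smul_mul_smul_comm, hz, mul_one, one_mul]
    have h1 : (1 + Complex.I) / 2 * ((1 + Complex.I) / 2) = Complex.I / 2 := by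
      linear_combination (1 / 4) * Complex.I_mul_I
    have h2 : (1 - Complex.I) / 2 * ((1 - Complex.I) / 2) = -Complex.I / 2 := by
      linear_combination (1 / 4) * Complex.I_mul_I
    have h3 : (1 + Complex.I) / 2 * ((1 - Complex.I) / 2) = 1 / 2 := by
      linear_combination (-1 / 4) * Complex.I_mul_I
    rw [mul_comm ((1 - Complex.I) / 2) ((1 + Complex.I) / 2), h1, h2, h3]
    module
  rw [show 4 = 2 * 2 by norm_num, pow_mul, sq (_ + _), this, sq, hz]

lemma preserves_phase (hG : ∀ g, CliffordGate q f g → g ∈ C) (i : Fin q) :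
    Preserves (complexGenerators C hC) (1 - Complex.I • pauliZ i) (1 + Complex.I • pauliZ i) := by
  have hg := hG _ (CliffordGate.s i)
  rw [gateS_eq] at hg
  have hI : star Complex.I * Complex.I = 1 := by simp
  have h := preserves_of_finite_order (hC := hC) (n := 3) (involution_combination_mem_unitary
    (pauliZ_mul_self i) (star_pauliZ i) hI) hg (phase_pow_four (pauliZ_mul_self i))
  rw [star_involution_combination (star_pauliZ i)] at h
  have h1 : (1 + Complex.I) / 2 ≠ 0 := fun h => by
    have := congrArg Complex.re h
    simp at this
  have h2 : (1 - Complex.I) / 2 ≠ 0 := fun h => by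
    have := congrArg Complex.re h
    simp at this
  refine Preserves.of_smul h1 h2 ?_
  convert h using 1
  · rw [smul_sub, smul_smul, show (1 + Complex.I) / 2 * Complex.I = -((1 - Complex.I) / 2) by
      linear_combination (1 / 2) * Complex.I_mul_I]
    module
  · rw [smul_add, smul_smul, show (1 - Complex.I) / 2 * Complex.I = (1 + Complex.I) / 2 by
      linear_combination (-1 / 2) * Complex.I_mul_I]
    simp only [Complex.star_def, Complex.conj_I]
    module

lemma pauliZ_commute_siteZ (i : Fin q) (j : Fin f) :
    (pauliZ i * siteZ j : Op q f) = siteZ j * pauliZ i := diagonal_commute _ _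

lemma preserves_czqf (hG : ∀ g, CliffordGate q f g → g ∈ C) (i : Fin q) (j : Fin f) :
    Preserves (complexGenerators C hC) (1 + pauliZ i + siteZ j - pauliZ i * siteZ j)
      (1 + pauliZ i + siteZ j - pauliZ i * siteZ j) := by
  have hg := hG _ (CliffordGate.czqf i j)
  rw [gateCZqf_eq] at hg
  have h0 : (2⁻¹ : ℂ) ≠ 0 := by norm_num
  refine Preserves.of_smul h0 h0 (preserves_of_involution ?_ hg ?_)
  · rw [star_smul, star_sub, star_add, star_add, star_mul, star_one, star_pauliZ, star_siteZ,
      pauliZ_commute_siteZ]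
    simp
  · simp only [smul_mul_smul_comm, mul_add, add_mul, mul_sub, sub_mul, mul_assoc, mul_one, one_mul,
      ← pauliZ_commute_siteZ, mul_assoc_of_eq (pauliZ_commute_siteZ i j).symm, pauliZ_mul_self,
      siteZ_mul_self, mul_assoc_of_eq_one (pauliZ_mul_self i),
      mul_assoc_of_eq_one (siteZ_mul_self j)]
    module

lemma gateBraid_pow_eight {i j : Fin f} (hij : i ≠ j) : (gateBraid i j : Op q f) ^ 8 = 1 := by
  let +nondep : NormedAlgebra ℚ (Op q f) := .restrictScalars ℚ ℂ _
  have h : (gateBraid i j : Op q f)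
      = exp ((Complex.I * ((Real.pi : ℂ) / 4)) • (majoranaPair i j : Op q f)) := rfl
  rw [h, ← exp_nsmul, ← Nat.cast_smul_eq_nsmul ℂ, smul_smul,
    show ((8 : ℕ) : ℂ) * (Complex.I * ((Real.pi : ℂ) / 4)) = Complex.I * (2 * Real.pi) by
      push_cast; ring,
    exp_smul_involution (majoranaPair_mul_self hij)]
  simp

lemma star_gateBraid {i j : Fin f} (hij : i ≠ j) : star (gateBraid i j : Op q f)
    = ((√2 / 2 : ℝ) : ℂ) • (1 - Complex.I • majoranaPair i j) := by
  rw [gateBraid_eq hij, star_smul, star_add, star_smul, star_majoranaPair hij, star_one,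
    Complex.star_def, Complex.conj_ofReal, Complex.conj_I, neg_smul, sub_eq_add_neg]

lemma gateBraid_mem_unitary {i j : Fin f} (hij : i ≠ j) :
    (gateBraid i j : Op q f) ∈ unitary (Op q f) := by
  have h2 : ((√2 / 2 : ℝ) : ℂ) * ((√2 / 2 : ℝ) : ℂ) = 2⁻¹ := by
    rw [← Complex.ofReal_mul, show √2 / 2 * (√2 / 2) = √2 * √2 / 4 by ring,
      Real.mul_self_sqrt two_pos.le]
    norm_num
  rw [Unitary.mem_iff, star_gateBraid hij, gateBraid_eq hij]
  constructor <;>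
  · simp only [smul_mul_smul_comm, h2, mul_add, add_mul, mul_sub, sub_mul, mul_one, one_mul,
      majoranaPair_mul_self hij, Complex.I_mul_I]
    module

lemma preserves_braid (hG : ∀ g, CliffordGate q f g → g ∈ C) {i j : Fin f} (hij : i ≠ j) :
    Preserves (complexGenerators C hC) (1 + Complex.I • majoranaPair i j)
      (1 - Complex.I • majoranaPair i j) := by
  have h := preserves_of_finite_order (hC := hC) (n := 7) (gateBraid_mem_unitary hij)
    (hG _ (CliffordGate.braid i j hij)) (gateBraid_pow_eight hij)
  rw [star_gateBraid hij, gateBraid_eq hij] at h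
  have h0 : ((√2 / 2 : ℝ) : ℂ) ≠ 0 := by
    rw [Complex.ofReal_ne_zero]
    exact div_ne_zero (Real.sqrt_ne_zero'.2 two_pos) two_ne_zero
  exact h.of_smul h0 h0

/-- A qubit as a control qubit. -/
def controlQubit (hC : IsClosed (C : Set (Op q f))) (hG : ∀ g, CliffordGate q f g → g ∈ C)
    (o : Fin q) : ControlQubit (complexGenerators C hC) where
  x := pauliX o
  z := pauliZ o
  xx := pauliX_mul_self o
  zz := pauliZ_mul_self o
  zx := pauliZ_mul_pauliX o
  hadamard := preserves_hadamard hG o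
  phase := preserves_phase hG o

variable (hG : ∀ g, CliffordGate q f g → g ∈ C) (o : Fin q)

lemma siteZ_mem_stabilizer (j : Fin f) : siteZ j ∈ (controlQubit hC hG o).stabilizer :=
  ControlQubit.mem_stabilizer_of_controlled (siteZ_mul_self j) (siteZ_commute_pauliX j o)
    (pauliZ_commute_siteZ o j).symm (preserves_czqf hG o j)

lemma majoranaPair_commute_pauliZ {i j : Fin f} (hij : i ≠ j) (k : Fin q) :
    (majoranaPair i j * pauliZ k : Op q f) = pauliZ k * majoranaPair i j :=
  majoranaPair_commute_diagonal hij fun d => by simp [siteFlip]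

lemma majoranaPair_mem_stabilizer {i j : Fin f} (hij : i ≠ j) :
    majoranaPair i j ∈ (controlQubit hC hG o).stabilizer :=
  ControlQubit.mem_stabilizer_of_braid (majoranaPair_mul_self hij)
    (majoranaPair_commute_pauliX hij o) (majoranaPair_commute_pauliZ hij o)
    (preserves_braid hG hij) (siteZ_mul_self i) (siteZ_mem_stabilizer hG o i)
    (siteZ_mul_majoranaPair hij)

/-- No gate couples two qubits directly; site `i` mediates between the qubits `k` and `o`. -/
lemma pauliZ_mem_stabilizer {i j : Fin f} (hij : i ≠ j) {k : Fin q} (hk : k ≠ o) :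
    pauliZ k ∈ (controlQubit hC hG o).stabilizer := by
  refine ControlQubit.mem_stabilizer_of_qubit (majoranaPair_mul_self hij) (siteZ_mul_self i)
    (pauliZ_mul_self k) (pauliZ_commute_pauliX hk) (diagonal_commute _ _)
    (siteZ_mem_stabilizer hG o i) (majoranaPair_mem_stabilizer hG o hij)
    (siteZ_mul_majoranaPair hij) (pauliZ_commute_siteZ k i)
    (majoranaPair_commute_pauliZ hij k).symm (controlQubit hC hG k).preserves_z ?_
    (preserves_czqf hG k i)
  exact ControlQubit.preserves_of_controlled (Q := controlQubit hC hG o) (siteZ_mul_self i)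
    (siteZ_commute_pauliX i o) (pauliZ_commute_siteZ o i).symm (preserves_czqf hG o i)

lemma pauliX_mem_stabilizer {i j : Fin f} (hij : i ≠ j) {k : Fin q} (hk : k ≠ o) :
    pauliX k ∈ (controlQubit hC hG o).stabilizer :=
  ControlQubit.mem_stabilizer_of_hadamard (pauliX_mul_self k) (pauliZ_mul_self k)
    (pauliZ_mul_pauliX k) (pauliX_commute k o) (pauliZ_commute_pauliX hk.symm).symm
    (pauliZ_mem_stabilizer hG o hij hk) (preserves_hadamard hG k)

/-- A function of the bits other than `o` is a polynomial in their signs, because the indicator of a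
bit value is affine in its sign. -/
lemma diagonal_mem_stabilizer {i j : Fin f} (hij : i ≠ j) {h : Conf q f → ℂ}
    (hh : ∀ c d : Conf q f, (∀ k, k ≠ o → c.1 k = d.1 k) → c.2 = d.2 → h c = h d) :
    Matrix.diagonal h ∈ (controlQubit hC hG o).stabilizer := by
  let D : Subalgebra ℂ (Conf q f → ℂ) :=
    (controlQubit hC hG o).stabilizer.comap (Matrix.diagonalAlgHom ℂ)
  have hind : ∀ (w : Conf q f → Fin 2) (b : Fin 2), (fun c => bitSign (w c)) ∈ D →
      (fun c => if w c = b then (1 : ℂ) else 0) ∈ D := by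
    intro w b hw
    have : (fun c => if w c = b then (1 : ℂ) else 0)
        = (2⁻¹ : ℂ) • (1 + bitSign b • fun c => bitSign (w c)) := by
      funext c
      have h1 : w c = 0 ∨ w c = 1 := by omega
      have h2 : b = 0 ∨ b = 1 := by omega
      rcases h1 with h1 | h1 <;> rcases h2 with h2 | h2 <;> simp [h1, h2] <;> norm_num
    rw [this]
    exact D.smul_mem (D.add_mem D.one_mem (D.smul_mem hw _)) _
  have hq : ∀ (d : Conf q f) (k : Fin q),
      (fun c : Conf q f => if k = o ∨ c.1 k = d.1 k then (1 : ℂ) else 0) ∈ D := by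
    intro d k
    by_cases hk : k = o
    · simp only [hk, true_or, if_true]; exact D.one_mem
    · simp only [hk, false_or]
      exact hind (fun c => c.1 k) _ (pauliZ_mem_stabilizer hG o hij hk)
  have hf : ∀ (d : Conf q f) (k : Fin f),
      (fun c : Conf q f => if c.2 k = d.2 k then (1 : ℂ) else 0) ∈ D := fun d k =>
    hind (fun c => c.2 k) _ (siteZ_mem_stabilizer hG o k)
  -- Bit `o` is ignored: the condition `d.1 o = 0` picks one representative per class, and the
  -- disjunct `k = o` makes its factor `1`.
  have key : h = ∑ d : Conf q f, (if d.1 o = 0 then h d else 0) •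
      ((∏ k : Fin q, fun c : Conf q f => if k = o ∨ c.1 k = d.1 k then (1 : ℂ) else 0)
        * ∏ k : Fin f, fun c : Conf q f => if c.2 k = d.2 k then (1 : ℂ) else 0) := by
    funext c
    rw [Finset.sum_apply, Finset.sum_eq_single (Function.update c.1 o 0, c.2)]
    · simp only [Pi.smul_apply, Pi.mul_apply, Finset.prod_apply, Function.update_self, if_true,
        smul_eq_mul]
      rw [Finset.prod_eq_one, Finset.prod_eq_one]
      · rw [mul_one, mul_one]
        exact hh _ _ (fun k hk => by simp [hk]) rfl
      · intro k _; simp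
      · intro k _
        by_cases hk : k = o <;> simp [hk]
    · intro d _ hd
      simp only [Pi.smul_apply, Pi.mul_apply, Finset.prod_apply, smul_eq_mul]
      by_contra hne
      apply hd
      have h1 := left_ne_zero_of_mul hne
      have h2 := left_ne_zero_of_mul (right_ne_zero_of_mul hne)
      have h3 := right_ne_zero_of_mul (right_ne_zero_of_mul hne)
      rw [Finset.prod_ne_zero_iff] at h2 h3
      have h1' : d.1 o = 0 := by
        by_contra h; simp [h] at h1
      refine Prod.ext (funext fun k => ?_) (funext fun k => ?_)
      · have := h2 k (Finset.mem_univ _)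
        by_cases hk : k = o
        · subst hk; simp [h1']
        · simp only [hk, false_or, ne_eq, ite_eq_right_iff, one_ne_zero, imp_false,
            not_not] at this
          simp [hk, this]
      · have := h3 k (Finset.mem_univ _)
        simp only [ne_eq, ite_eq_right_iff, one_ne_zero, imp_false, not_not] at this
        simp [this]
    · simp
  have : h ∈ D := by
    rw [key]
    exact D.sum_mem fun d _ => D.smul_mem (D.mul_mem (D.prod_mem fun k _ => hq d k)
      (D.prod_mem fun k _ => hf d k)) _
  exact this

lemma shift_siteFlip_mem_stabilizer {i j : Fin f} (hij : i ≠ j) :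
    shift (siteFlip i + siteFlip j) ∈ (controlQubit hC hG o).stabilizer := by
  have h1 : (shift (siteFlip i + siteFlip j) : Op q f)
      = majoranaPair i j * Matrix.diagonal fun d => majoranaSign i j d.2 := by
    rw [majoranaPair_eq hij, mul_assoc,
      diagonal_mul_self_of_sq fun d => majoranaSign_mul_self i j d.2, mul_one]
  rw [h1]
  exact mul_mem (majoranaPair_mem_stabilizer hG o hij)
    (diagonal_mem_stabilizer hG o hij fun c d _ h => by rw [h])

lemma shift_mem_stabilizer {i j : Fin f} (hij : i ≠ j) {v : Conf q f} (ho : v.1 o = 0)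
    (hv : ∑ k, v.2 k = 0) : shift v ∈ (controlQubit hC hG o).stabilizer := by
  let S : AddSubmonoid (Conf q f) :=
    { carrier := {w | shift w ∈ (controlQubit hC hG o).stabilizer}
      zero_mem' := by
        change shift 0 ∈ (controlQubit hC hG o).stabilizer
        rw [shift_zero]; exact one_mem _
      add_mem' := by
        intro a b ha hb
        change shift (a + b) ∈ (controlQubit hC hG o).stabilizer
        rw [← shift_mul_shift]; exact mul_mem ha hb }
  have h1 : (∑ k : Fin q, if v.1 k = 1 then ((Pi.single k 1, 0) : Conf q f) else 0) ∈ S := by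
    refine S.sum_mem fun k _ => ?_
    split_ifs with hk
    · exact pauliX_mem_stabilizer hG o hij (fun h => by subst h; simp [ho] at hk)
    · exact S.zero_mem
  -- Every flipped site is paired with the fixed site `i`; their number is even, so the added flips
  -- of `i` cancel.
  have h2 : (∑ k : Fin f, if v.2 k = 1 then (siteFlip k + siteFlip i : Conf q f) else 0) ∈ S := by
    refine S.sum_mem fun k _ => ?_
    split_ifs with hk
    · by_cases hki : k = i
      · rw [hki, conf_add_self]; exact S.zero_mem
      · exact shift_siteFlip_mem_stabilizer hG o hki
    · exact S.zero_mem
  have key : v = (∑ k : Fin q, if v.1 k = 1 then ((Pi.single k 1, 0) : Conf q f) else 0)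
      + ∑ k : Fin f, if v.2 k = 1 then (siteFlip k + siteFlip i : Conf q f) else 0 := by
    have e1 : ∀ k : Fin f, (if v.2 k = 1 then (siteFlip k + siteFlip i : Conf q f) else 0)
        = (0, Pi.single k (v.2 k) + Pi.single i (v.2 k)) := by
      intro k
      have h2 : v.2 k = 0 ∨ v.2 k = 1 := by omega
      rcases h2 with h | h
      · rw [h]; simp; rfl
      · simp [h, siteFlip]
    have e2 : ∀ k : Fin q, (if v.1 k = 1 then ((Pi.single k 1, 0) : Conf q f) else 0)
        = (Pi.single k (v.1 k), 0) := by
      intro k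
      have h2 : v.1 k = 0 ∨ v.1 k = 1 := by omega
      rcases h2 with h | h
      · rw [h]; simp; rfl
      · simp [h]
    simp only [e1, e2]
    refine Prod.ext ?_ ?_
    · rw [Prod.fst_add, Prod.fst_sum, Prod.fst_sum, Finset.univ_sum_single]
      simp
    · rw [Prod.snd_add, Prod.snd_sum, Prod.snd_sum, Finset.sum_add_distrib,
        Finset.univ_sum_single]
      have : ∑ k, (Pi.single i (v.2 k) : Fin f → Fin 2) = Pi.single i (∑ k, v.2 k) :=
        (map_sum (AddMonoidHom.single (fun _ => Fin 2) i) _ _).symm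
      rw [this, hv]
      simp
  have : v ∈ S := by
    rw [key]; exact S.add_mem h1 h2
  exact this

lemma eq_sum_shift_mul_diagonal (W : Op q f) :
    W = ∑ v : Conf q f, shift v * Matrix.diagonal fun d => W (d + v) d := by
  ext c d
  rw [Matrix.sum_apply, Finset.sum_eq_single (c + d)]
  · rw [shift_mul_apply, Matrix.diagonal_apply, ← add_assoc, conf_add_self, zero_add, if_pos rfl,
      add_comm c d, ← add_assoc, conf_add_self, zero_add]
  · intro v _ hv
    rw [shift_mul_apply, Matrix.diagonal_apply, if_neg]
    rintro rfl
    apply hv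
    rw [← add_assoc, conf_add_self, zero_add]
  · simp

/-- The stabilizer contains all operators that conserve the fermion parity and act trivially on
the control qubit. -/
lemma mem_stabilizer_of_parity {i j : Fin f} (hij : i ≠ j) {W : Op q f}
    (h1 : ∀ c d, c.1 o ≠ d.1 o → W c d = 0)
    (h2 : ∀ c d, ∑ k, c.2 k ≠ ∑ k, d.2 k → W c d = 0)
    (h3 : ∀ c d, W (c + (Pi.single o 1, 0)) (d + (Pi.single o 1, 0)) = W c d) :
    W ∈ (controlQubit hC hG o).stabilizer := by
  rw [eq_sum_shift_mul_diagonal W]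
  refine Subalgebra.sum_mem _ fun v _ => ?_
  -- Shifts that flip `o` or change the parity occur with zero coefficient.
  by_cases hv : v.1 o = 0 ∧ ∑ k, v.2 k = 0
  · refine mul_mem (shift_mem_stabilizer hG o hij hv.1 hv.2)
      (diagonal_mem_stabilizer hG o hij fun c d hcd hcd' => ?_)
    by_cases ho : c.1 o = d.1 o
    · have : c = d := by
        refine Prod.ext (funext fun k => ?_) hcd'
        by_cases hk : k = o
        · rw [hk, ho]
        · exact hcd k hk
      rw [this]
    · have : c = d + (Pi.single o 1, 0) := by
        refine Prod.ext (funext fun k => ?_) (by simpa using hcd')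
        by_cases hk : k = o
        · subst hk
          have hc : c.1 k = 0 ∨ c.1 k = 1 := by omega
          have hd : d.1 k = 0 ∨ d.1 k = 1 := by omega
          rcases hc with hc | hc <;> rcases hd with hd | hd <;> simp_all
        · simpa [hk] using hcd k hk
      rw [this, add_right_comm, h3]
  · have : (fun d => W (d + v) d) = 0 := by
      funext d
      rw [not_and_or] at hv
      rcases hv with hv | hv
      · refine h1 _ _ fun h => hv ?_
        simpa using h
      · refine h2 _ _ fun h => hv ?_
        simpa [Finset.sum_add_distrib] using h
    rw [this, show Matrix.diagonal (0 : Conf q f → ℂ) = 0 from Matrix.diagonal_zero, mul_zero]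
    exact Subalgebra.zero_mem _

end Circuits

/-! ### Non-Clifford seeds, logarithms and approximation -/

section Universality

open scoped Matrix.Norms.L2Operator

section Seeds

variable {q f : ℕ} {C : Submonoid (Op q f)} {hC : IsClosed (C : Set (Op q f))}
  (hG : ∀ g, CliffordGate q f g → g ∈ C) (o : Fin q)

lemma one_mem_targets_of_gateT (hT : gateT o ∈ C) : 1 ∈ (controlQubit hC hG o).targets := by
  refine ControlQubit.targets_of_z_mul_mem (by simp) (by simp) ?_
  change pauliZ o * 1 ∈ _
  rw [mul_one]
  have hH := hG _ (CliffordGate.h o)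
  -- Conjugated by the Hadamard gate, `T` becomes the same phase gate about the `X` axis, which
  -- anticommutes with `Z`.
  have hHTH := mul_mem (mul_mem hH hT) hH
  rw [gateT_eq] at hT
  refine mem_complexGenerators_of_T (pauliZ_mul_self o) (pauliX_mul_self o) (star_pauliZ o)
    (star_pauliX o) (by rw [pauliZ_mul_pauliX, neg_neg]) rfl hT ?_
  convert hHTH using 1
  have h2 : (((Real.sqrt 2 : ℝ) : ℂ)⁻¹) * (((Real.sqrt 2 : ℝ) : ℂ)⁻¹) = 2⁻¹ := by
    rw [← mul_inv, ← Complex.ofReal_mul, Real.mul_self_sqrt two_pos.le]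
    norm_num
  have hzx := pauliZ_mul_pauliX (f := f) o
  rw [gateT_eq, gateH_eq, smul_mul_assoc, smul_mul_smul_comm, h2]
  simp only [mul_add, add_mul, mul_smul_comm, smul_mul_assoc, mul_assoc, mul_one, one_mul,
    pauliX_mul_self, pauliZ_mul_self, mul_assoc_of_eq_one (pauliX_mul_self (f := f) o),
    mul_assoc_of_eq_one (pauliZ_mul_self (f := f) o), hzx, mul_assoc_of_eq_neg hzx, mul_neg]
  module

/-- Braiding rotates the axis `P` of the gate to the anticommuting axis `i M P`, so `P` is in `V`.
Braiding again gives `M P`, and the controlled phase turns this into `Z M P` because `M P`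
anticommutes with `P`. Hence `M P` is a target. -/
lemma one_mem_targets_of_gateTf {i j : Fin f} (hij : i ≠ j) (hT : gateTf i ∈ C) :
    1 ∈ (controlQubit hC hG o).targets := by
  set V := complexGenerators C hC with hV
  set M : Op q f := majoranaPair i j with hMdef
  set P : Op q f := siteZ i with hPdef
  have hMM : M * M = 1 := majoranaPair_mul_self hij
  have hPP : P * P = 1 := siteZ_mul_self i
  have hPM : P * M = -(M * P) := siteZ_mul_majoranaPair hij
  have hMs : star M = M := star_majoranaPair hij
  have hPs : star P = P := star_siteZ i
  have hzM : pauliZ o * M = M * pauliZ o := (majoranaPair_commute_pauliZ hij o).symm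
  have hzP : pauliZ o * P = P * pauliZ o := pauliZ_commute_siteZ o i
  have hP : P ∈ V := by
    have hB := hG _ (CliffordGate.braid i j hij)
    have hB' := star_mem_of_pow_eq_one (gateBraid_mem_unitary hij) hB
      (n := 7) (gateBraid_pow_eight hij)
    have hBT := mul_mem (mul_mem hB hT) hB'
    rw [gateTf_eq] at hT
    have hQQ : (Complex.I • (M * P)) * (Complex.I • (M * P)) = 1 := by
      rw [smul_mul_smul_comm, Complex.I_mul_I, mul_assoc, mul_assoc_of_eq_neg hPM, hPP, mul_neg,
        mul_one, hMM]
      simp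
    refine mem_complexGenerators_of_T hPP hQQ hPs ?_ ?_ rfl hT ?_
    · rw [star_smul, star_mul, hPs, hMs, hPM]
      simp
    · rw [smul_mul_assoc, mul_smul_comm, mul_assoc, mul_assoc_of_eq_neg hPM, smul_neg, neg_neg]
    · convert hBT using 1
      have h2 : ((√2 / 2 : ℝ) : ℂ) * ((√2 / 2 : ℝ) : ℂ) = 2⁻¹ := by
        rw [← Complex.ofReal_mul, show √2 / 2 * (√2 / 2) = √2 * √2 / 4 by ring,
          Real.mul_self_sqrt two_pos.le]
        norm_num
      rw [star_gateBraid hij, gateBraid_eq hij, gateTf_eq, smul_mul_assoc, smul_mul_smul_comm, h2]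
      simp only [← hMdef, ← hPdef, mul_add, add_mul, mul_sub, mul_smul_comm, smul_mul_assoc,
        mul_assoc, mul_one, one_mul, hMM, hPP, hPM, mul_assoc_of_eq_one hMM,
        mul_assoc_of_eq_neg hPM, mul_neg, smul_smul, smul_neg]
      match_scalars <;> ring_nf <;> simp only [Complex.I_sq] <;> ring
  have hMP : M * P ∈ V := by
    have h := preserves_braid (hC := hC) hG hij P hP
    have h2I : (2 * Complex.I : ℂ) ≠ 0 := mul_ne_zero two_ne_zero Complex.I_ne_zero
    refine (V.smul_mem_iff h2I).1 ?_
    convert h using 1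
    simp only [← hMdef, add_mul, mul_sub, mul_smul_comm, smul_mul_assoc, mul_assoc, mul_one,
      one_mul, hMM, hPM, mul_assoc_of_eq_one hMM, mul_neg, neg_mul, smul_smul, smul_neg, smul_add,
      smul_sub, Complex.I_mul_I]
    module
  have hzMP : pauliZ o * (M * P) ∈ V := by
    have h := preserves_czqf (hC := hC) hG o i (M * P) hMP
    refine (V.smul_mem_iff (show (4 : ℂ) ≠ 0 by norm_num)).1 ?_
    convert h using 1
    simp only [← hPdef, add_mul, mul_add, sub_mul, mul_sub, mul_assoc, mul_one, one_mul, hPP,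
      mul_assoc_of_eq_one hPP, ← hzP, mul_assoc_of_eq hzP.symm, ← hzM, mul_assoc_of_eq hzM.symm,
      mul_assoc_of_eq_one (pauliZ_mul_self (f := f) o), pauliZ_mul_self, hPM,
      mul_assoc_of_eq_neg hPM, mul_neg, neg_mul, neg_neg]
    module
  have hPst : P ∈ (controlQubit hC hG o).stabilizer := siteZ_mem_stabilizer hG o i
  have hMst : M ∈ (controlQubit hC hG o).stabilizer := majoranaPair_mem_stabilizer hG o hij
  have hst := mul_mem hMst hPst
  have ht : M * P ∈ (controlQubit hC hG o).targets :=
    ControlQubit.targets_of_z_mul_mem hst.1 hst.2.1 hzMP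
  -- Both `M` and `P` stabilize the targets, and `P (M (M P)) = 1`.
  have := hPst.2.2 _ (hMst.2.2 _ ht)
  rwa [mul_assoc_of_eq_one hMM, hPP] at this

/-- Rotations generated by `Z ⊗ W`, for a parity conserving `W`, can be approximated. -/
lemma exp_mem_of_parity (h1 : 1 ∈ (controlQubit hC hG o).targets) {i j : Fin f} (hij : i ≠ j)
    {W : Op q f} (hW : star W = W)
    (hW1 : ∀ c d, c.1 o ≠ d.1 o → W c d = 0)
    (hW2 : ∀ c d, ∑ k, c.2 k ≠ ∑ k, d.2 k → W c d = 0)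
    (hW3 : ∀ c d, W (c + (Pi.single o 1, 0)) (d + (Pi.single o 1, 0)) = W c d) :
    exp (Complex.I • (pauliZ o * W)) ∈ C := by
  have hst := mem_stabilizer_of_parity (hC := hC) hG o hij hW1 hW2 hW3
  have ht := hst.2.2 _ h1
  rw [mul_one] at ht
  have hV := (complexGenerators C hC).smul_mem Complex.I (ControlQubit.z_mul_mem_of_targets ht)
  have hcomm : W * pauliZ o = pauliZ o * W := hst.2.1
  have := (generators_of_complexGenerators hV (by
    change star (Complex.I • (pauliZ o * W)) = -(Complex.I • (pauliZ o * W))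
    rw [star_smul, star_mul, hW, star_pauliZ, hcomm]
    simp)).2 1
  rwa [one_smul] at this

end Seeds

/-- Every unitary matrix is the exponential of `i K` for a self-adjoint matrix `K` in its
bicommutant. -/
lemma exists_log_of_unitary {n : Type*} [Fintype n] [DecidableEq n] {U : Matrix n n ℂ}
    (hU : U ∈ unitary (Matrix n n ℂ)) :
    ∃ K : Matrix n n ℂ, star K = K ∧ exp (Complex.I • K) = U ∧ ∀ B, Commute U B → Commute K B := by
  have hN : IsStarNormal U := isStarNormal_of_mem_unitary hU
  -- The spectrum is finite, so the branch cut of `arg` does no harm in the functional calculus.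
  have hcont : ∀ g : ℂ → ℂ, ContinuousOn g (spectrum ℂ U) := fun g =>
    (Matrix.finite_spectrum U).continuousOn g
  refine ⟨cfc (fun z : ℂ => (Complex.arg z : ℂ)) U, ?_, ?_, ?_⟩
  · rw [← cfc_star]
    congr 1
    funext z
    simp
  · rw [← cfc_const_mul Complex.I (fun z : ℂ => (Complex.arg z : ℂ)) U (hcont _),
      ← CFC.complex_exp_eq_normedSpace_exp (cfc_predicate _ _),
      ← cfc_comp' Complex.exp (fun z : ℂ => Complex.I * (Complex.arg z : ℂ)) U
        Complex.continuous_exp.continuousOn (hcont _)]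
    conv_rhs => rw [← cfc_id ℂ U]
    refine cfc_congr fun z hz => ?_
    have hz1 : ‖z‖ = 1 := by
      simpa using spectrum.subset_circle_of_unitary hU hz
    have := Complex.norm_mul_exp_arg_mul_I z
    rw [hz1] at this
    simp only [id]
    rw [mul_comm]
    simpa using this
  · intro B hB
    refine hB.cfc ?_ _
    have h1 := (Unitary.mem_iff.1 hU).1
    have h2 := (Unitary.mem_iff.1 hU).2
    calc star U * B = star U * B * (U * star U) := by rw [h2, mul_one]
      _ = star U * (B * U) * star U := by simp only [mul_assoc]
      _ = star U * (U * B) * star U := by rw [hB.eq]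
      _ = B * star U := by rw [← mul_assoc (star U) U, h1, one_mul]

lemma exp_mul_of_intertwine {m n : Type*} [Fintype m] [DecidableEq m] [Fintype n] [DecidableEq n]
    {X : Matrix m m ℂ} {Y : Matrix n n ℂ} {J : Matrix m n ℂ} (h : X * J = J * Y) :
    exp X * J = J * exp Y := by
  let +nondep : NormedAlgebra ℚ (Matrix m m ℂ) := .restrictScalars ℚ ℂ _
  let +nondep : NormedAlgebra ℚ (Matrix n n ℂ) := .restrictScalars ℚ ℂ _
  have hpow : ∀ k : ℕ, X ^ k * J = J * Y ^ k := by
    intro k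
    induction k with
    | zero => simp
    | succ k ih => rw [pow_succ, pow_succ, Matrix.mul_assoc, h, ← Matrix.mul_assoc, ih, Matrix.mul_assoc]
  have h1 := (exp_series_hasSum_exp' (𝕂 := ℂ) X).map
    ({ toFun := fun M => M * J, map_zero' := Matrix.zero_mul _,
       map_add' := fun a b => Matrix.add_mul a b J } : Matrix m m ℂ →+ Matrix m n ℂ)
    (show Continuous fun M : Matrix m m ℂ => M * J from continuous_id.matrix_mul continuous_const)
  have h2 := (exp_series_hasSum_exp' (𝕂 := ℂ) Y).map
    ({ toFun := fun M => J * M, map_zero' := Matrix.mul_zero _,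
       map_add' := fun a b => Matrix.mul_add J a b } : Matrix n n ℂ →+ Matrix m n ℂ)
    (show Continuous fun M : Matrix n n ℂ => J * M from continuous_const.matrix_mul continuous_id)
  refine HasSum.unique h1 (Eq.mp (congrArg (HasSum · (J * exp Y)) ?_) h2)
  funext k
  symm
  change (((k.factorial : ℂ)⁻¹) • X ^ k) * J = J * (((k.factorial : ℂ)⁻¹) • Y ^ k)
  rw [Matrix.smul_mul, Matrix.mul_smul, hpow]

/-! ### Ancillas -/

variable {q f : ℕ}

/-- The matrix of `attach`. -/
def attachMatrix (q f a b : ℕ) : Matrix (Conf (q + a) (f + b)) (Conf q f) ℂ :=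
  fun d c => if d = padConf a b c then 1 else 0

lemma attach_eq (a b : ℕ) (ψ : States q f) :
    attach a b ψ = WithLp.toLp 2 (attachMatrix q f a b *ᵥ ψ.ofLp) := by
  rw [attach]
  congr 1
  funext d
  simp [Matrix.mulVec, dotProduct, attachMatrix]

/-- The configuration of the system qubits and sites. -/
def systemConf {a b : ℕ} (d : Conf (q + a) (f + b)) : Conf q f :=
  (fun k => d.1 (Fin.castAdd a k), fun k => d.2 (Fin.castAdd b k))

lemma systemConf_padConf (a b : ℕ) (c : Conf q f) : systemConf (padConf a b c) = c := by
  simp [systemConf, padConf]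

lemma eq_padConf_iff {a b : ℕ} (d : Conf (q + a) (f + b)) (c : Conf q f) :
    d = padConf a b c ↔ systemConf d = c ∧ (∀ k, d.1 (Fin.natAdd q k) = 0)
      ∧ ∀ k, d.2 (Fin.natAdd f k) = 0 := by
  constructor
  · rintro rfl
    exact ⟨systemConf_padConf a b c, fun k => by simp [padConf], fun k => by simp [padConf]⟩
  · rintro ⟨rfl, h1, h2⟩
    refine Prod.ext (funext fun k => ?_) (funext fun k => ?_)
    · refine Fin.addCases (fun k => ?_) (fun k => ?_) k
      · simp [padConf, systemConf]
      · simp [padConf, h1]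
    · refine Fin.addCases (fun k => ?_) (fun k => ?_) k
      · simp [padConf, systemConf]
      · simp [padConf, h2]

/-- An operator on the system, extended by the identity to the ancillas. -/
def extend (a b : ℕ) (K : Op q f) : Op (q + a) (f + b) := fun d e =>
  if (∀ k, d.1 (Fin.natAdd q k) = e.1 (Fin.natAdd q k))
      ∧ (∀ k, d.2 (Fin.natAdd f k) = e.2 (Fin.natAdd f k))
    then K (systemConf d) (systemConf e) else 0

lemma star_extend (a b : ℕ) {K : Op q f} (hK : star K = K) :
    star (extend a b K) = extend a b K := by
  ext d e
  rw [Matrix.star_apply]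
  simp only [extend]
  by_cases h : (∀ k, d.1 (Fin.natAdd q k) = e.1 (Fin.natAdd q k))
      ∧ (∀ k, d.2 (Fin.natAdd f k) = e.2 (Fin.natAdd f k))
  · rw [if_pos h, if_pos ⟨fun k => (h.1 k).symm, fun k => (h.2 k).symm⟩]
    conv_rhs => rw [← hK]
    rw [Matrix.star_apply]
  · rw [if_neg h, if_neg fun h' => h ⟨fun k => (h'.1 k).symm, fun k => (h'.2 k).symm⟩]
    exact star_zero _

/-- The ancilla qubit is in `|0⟩`, where its `Z` equals `1`. -/
lemma pauliZ_mul_extend_mul_attachMatrix (b : ℕ) (K : Op q f) :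
    pauliZ (Fin.natAdd q 0) * extend 1 b K * attachMatrix q f 1 b = attachMatrix q f 1 b * K := by
  ext d c
  have h1 : (pauliZ (Fin.natAdd q 0) * extend 1 b K * attachMatrix q f 1 b :
      Matrix (Conf (q + 1) (f + b)) (Conf q f) ℂ) d c
      = bitSign (d.1 (Fin.natAdd q 0)) * extend 1 b K d (padConf 1 b c) := by
    rw [Matrix.mul_assoc, pauliZ, Matrix.diagonal_mul, Matrix.mul_apply,
      Finset.sum_eq_single (padConf 1 b c)]
    · simp [attachMatrix]
    · intro e _ he
      simp [attachMatrix, he]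
    · simp
  rw [h1, Matrix.mul_apply]
  by_cases h : d = padConf 1 b (systemConf d)
  · rw [Finset.sum_eq_single (systemConf d)]
    · obtain ⟨-, h2, h3⟩ := (eq_padConf_iff d _).1 h
      rw [attachMatrix, if_pos h, one_mul, h2, bitSign_zero, one_mul, extend, if_pos,
        systemConf_padConf]
      exact ⟨fun k => by rw [h2]; simp [padConf], fun k => by rw [h3]; simp [padConf]⟩
    · intro e _ he
      rw [attachMatrix, if_neg, zero_mul]
      intro h'
      exact he ((eq_padConf_iff d e).1 h').1.symm
    · simp
  · rw [Finset.sum_eq_zero, extend, if_neg, mul_zero]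
    · rintro ⟨h2, h3⟩
      apply h
      rw [eq_padConf_iff]
      exact ⟨rfl, fun k => by rw [h2]; simp [padConf], fun k => by rw [h3]; simp [padConf]⟩
    · intro e _
      rw [attachMatrix, if_neg, zero_mul]
      intro h'
      apply h
      rwa [((eq_padConf_iff d e).1 h').1]

/-- Commuting with a diagonal matrix kills the entries between distinct eigenvalues. -/
lemma eq_zero_of_commute_parity {K : Op q f} (hK : Commute K (parity q f)) (c d : Conf q f)
    (h : ∑ k, c.2 k ≠ ∑ k, d.2 k) : K c d = 0 := by
  have := congrFun (congrFun hK.eq c) d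
  rw [parity_eq, Matrix.mul_diagonal, Matrix.diagonal_mul, mul_comm] at this
  have hne : bitSign (∑ k, d.2 k) - bitSign (∑ k, c.2 k) ≠ 0 := by
    generalize ∑ k, c.2 k = x at h
    generalize ∑ k, d.2 k = y at h
    fin_cases x <;> fin_cases y <;> first | exact absurd rfl h | norm_num [bitSign]
  have h0 : (bitSign (∑ k, d.2 k) - bitSign (∑ k, c.2 k)) * K c d = 0 := by
    rw [sub_mul, this, sub_self]
  exact (mul_eq_zero.1 h0).resolve_left hne

/-- The two gate sets differ only in how `1` is shown to be a target, so that is left as the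
hypothesis `h1`. -/
lemma isUniversal_of_one_mem_targets {G : ∀ q f : ℕ, Set (Op q f)}
    (hG : ∀ q f g, CliffordGate q f g → g ∈ G q f)
    (h1 : ∀ (q f : ℕ) (C : Submonoid (Op q f)) (hC : IsClosed (C : Set (Op q f)))
      (hGC : ∀ g ∈ G q f, g ∈ C) (o : Fin q) (i j : Fin f), i ≠ j →
      1 ∈ (controlQubit hC (fun g hg => hGC g (hG q f g hg)) o).targets) :
    IsUniversal G := by
  intro q f
  -- The qubit is the control; the two sites provide a pair `i ≠ j` even when `f = 0`.
  refine ⟨1, 2, fun U hU ε hε => ?_⟩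
  obtain ⟨K, hK, hexp, hcomm⟩ := exists_log_of_unitary hU.1
  have hKp := hcomm _ hU.2
  let C : Submonoid (Op (q + 1) (f + 2)) :=
    (Submonoid.closure (G (q + 1) (f + 2))).topologicalClosure
  have hC : IsClosed (C : Set (Op (q + 1) (f + 2))) := Submonoid.isClosed_topologicalClosure _
  have hGC : ∀ g ∈ G (q + 1) (f + 2), g ∈ C := fun g hg =>
    Submonoid.le_topologicalClosure _ (Submonoid.subset_closure hg)
  have hij : (Fin.natAdd f 0 : Fin (f + 2)) ≠ Fin.natAdd f 1 := by
    simp [Fin.ext_iff]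
  set o : Fin (q + 1) := Fin.natAdd q 0 with ho
  have hmem : exp (Complex.I • (pauliZ o * extend 1 2 K)) ∈ C := by
    refine exp_mem_of_parity (hC := hC) _ o (h1 _ _ C hC hGC o _ _ hij) hij (star_extend 1 2 hK)
      ?_ ?_ ?_
    · intro c d hcd
      rw [extend, if_neg]
      exact fun h => hcd (h.1 0)
    · intro c d hcd
      rw [extend]
      split_ifs with h
      · refine eq_zero_of_commute_parity hKp _ _ fun hs => hcd ?_
        rw [Fin.sum_univ_add, Fin.sum_univ_add]
        exact congrArg₂ (· + ·) hs (Finset.sum_congr rfl fun k _ => h.2 k)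
      · rfl
    · intro c d
      have hs : ∀ c : Conf (q + 1) (f + 2), systemConf (c + (Pi.single o 1, 0)) = systemConf c := by
        intro c
        refine Prod.ext (funext fun k => ?_) (funext fun k => ?_)
        · have : Fin.castAdd 1 k ≠ o := by
            rw [ho, ne_eq, Fin.ext_iff]
            simp only [Fin.val_castAdd, Fin.val_natAdd]
            omega
          simp [systemConf, this]
        · simp [systemConf]
      simp only [extend, hs, Prod.fst_add, Prod.snd_add, Pi.add_apply, add_left_inj]
  set E := exp (Complex.I • (pauliZ o * extend 1 2 K)) with hE
  have hint : E * attachMatrix q f 1 2 = attachMatrix q f 1 2 * U := by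
    rw [hE, ← hexp]
    apply exp_mul_of_intertwine
    rw [Matrix.smul_mul, Matrix.mul_smul, pauliZ_mul_extend_mul_attachMatrix]
  have hcl : E ∈ closure ((Submonoid.closure (G (q + 1) (f + 2)) : Set (Op (q + 1) (f + 2)))) := hmem
  set J := attachMatrix q f 1 2 with hJ
  -- The summand `1` keeps the denominator positive without computing `‖J‖`.
  have hδ : 0 < ε / (‖J‖ + 1) := by positivity
  obtain ⟨V, hV, hdist⟩ := Metric.mem_closure_iff.1 hcl _ hδ
  obtain ⟨L, hL, rfl⟩ := Submonoid.exists_list_of_mem_closure hV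
  refine ⟨L.prod, ⟨L, hL, rfl⟩, fun ψ => ?_⟩
  have hdiff : (L.prod).app (attach 1 2 ψ) - attach 1 2 (U.app ψ)
      = WithLp.toLp 2 ((L.prod - E) *ᵥ (WithLp.toLp 2 (J *ᵥ ψ.ofLp) : States (q + 1) (f + 2)).ofLp) := by
    rw [attach_eq, attach_eq, Op.app, Op.app, ← WithLp.toLp_sub, Matrix.sub_mulVec]
    simp only [Matrix.mulVec_mulVec, ← hJ, hint]
  rw [hdiff]
  refine (Matrix.l2_opNorm_mulVec _ _).trans ?_
  have hn1 : ‖L.prod - E‖ ≤ ε / (‖J‖ + 1) := by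
    rw [← dist_eq_norm, dist_comm]; exact hdist.le
  have hn2 : ‖(WithLp.toLp 2 (J *ᵥ ψ.ofLp) : States (q + 1) (f + 2))‖ ≤ (‖J‖ + 1) * ‖ψ‖ :=
    (Matrix.l2_opNorm_mulVec J ψ).trans
      (mul_le_mul_of_nonneg_right (by linarith) (norm_nonneg _))
  calc _ ≤ ε / (‖J‖ + 1) * ((‖J‖ + 1) * ‖ψ‖) :=
        mul_le_mul hn1 hn2 (norm_nonneg _) hδ.le
    _ = ε * ‖ψ‖ := by
        rw [← mul_assoc, div_mul_cancel₀]
        positivity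

end Universality

end QubitFermion

end

theorem proposition2 :
    QubitFermion.IsUniversal QubitFermion.gatesWithT ∧
      QubitFermion.IsUniversal QubitFermion.gatesWithTf := by
  refine ⟨QubitFermion.isUniversal_of_one_mem_targets (fun _ _ _ h => Or.inl h) ?_,
    QubitFermion.isUniversal_of_one_mem_targets (fun _ _ _ h => Or.inl h) ?_⟩
  · intro q f C hC hGC o i j _
    exact QubitFermion.one_mem_targets_of_gateT _ o (hGC _ (Or.inr ⟨o, rfl⟩))
  · intro q f C hC hGC o i j hij
    exact QubitFermion.one_mem_targets_of_gateTf _ o hij (hGC _ (Or.inr ⟨i, rfl⟩))
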